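/- Let $N\ge 1$ and let $\mathcal H_1,\dots,\mathcal H_{2N}$ be nonzero finite-dimensional complex Hilbert spaces with fixed bases, $d_i=\dim\mathcal H_i$; a subscript on $\operatorname{tr}$, on a transposition $T$ or on $\mathbb 1$ indicates the spaces on which it acts. A positive semidefinite operator $C$ on $\mathcal H_1\otimes\cdots\otimes\mathcal H_{2N}$ is a comb in $\mathrm{Comb}[(\mathcal H_1,\mathcal H_2),\dots,(\mathcal H_{2N-1},\mathcal H_{2N})]$ if there are positive semidefinite operators $C^{(k)}$ on $\mathcal H_1\otimes\cdots\otimes\mathcal H_{2k}$, $1\le k\le N-1$, such that with $C^{(0)}=1$, $C^{(N)}=C$ one has $\operatorname{tr}_{2k}C^{(k)}=\mathbb 1_{2k-1}\otimes C^{(k-1)}$ for $1\le k\le N$. A probe with ancilla $\mathcal H_{\rm aux}$ (of arbitrary finite dimension) is a comb $T\in\mathrm{Comb}[(\emptyset,\mathcal H_1),(\mathcal H_2,\mathcal H_3),\dots,(\mathcal H_{2N-2},\mathcal H_{2N-1}\otimes\mathcal H_{\rm aux})]$, where $\emptyset$ is the trivial input space $\mathbb C$; it is pure if $T=|\psi\rangle\langle\psi|$.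 The output state is $C*T=\operatorname{tr}_{1\dots 2N-1}[(C^{T_{1\dots 2N-1}}\otimes\mathbb 1_{\rm aux})(\mathbb 1_{2N}\otimes T)]$ on $\mathcal H_{2N}\otimes\mathcal H_{\rm aux}$. The quantum Fisher information of a differentiable family of states is $J(\rho_\theta)=\operatorname{tr}[\rho_\theta L^2]$, where $L$ is any Hermitian solution of $\dot\rho_\theta=\tfrac12(L\rho_\theta+\rho_\theta L)$ (the value does not depend on $L$), and the comb QFI is $J(C_\theta)=\max_T J(C_\theta*T)$ over all probes. Let $\Theta\subseteq\mathbb R$ be open, let $C_t\in\mathrm{Comb}[(\mathcal H_1,\mathcal H_2),\dots,(\mathcal H_{2N-1},\mathcal H_{2N})]$ for $t\in\Theta$, and suppose that 1. $C_t=\sum_{i=1}^{q}|C_{t,i}\rangle\langle C_{t,i}|$ for all $t\in\Theta$, with $t\mapsto|C_{t,i}\rangle$ continuously differentiable on $\Theta$ (for instance with $q=\max_t\operatorname{rank}C_t$); 2. for every pure probe $T$ the rank of $C_t*T$ does not depend on $t\in\Theta$. Fix $\theta\in\Theta$. For $h\in\mathrm{Herm}(\mathbb C^q)$ put $|\dot{\tilde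 C}_{\theta,i}\rangle=|\dot C_{\theta,i}\rangle-\mathrm i\sum_j h_{ij}|C_{\theta,j}\rangle$ and $\Omega_\theta(h)=4\sum_i\big(|\dot{\tilde C}_{\theta,i}\rangle\langle\dot{\tilde C}_{\theta,i}|\big)^{T_{1\dots 2N-1}}$. For $1\le m\le d_{2N}$ let $|c_{i,m}\rangle$ be the vector in $\mathcal H_1\otimes\cdots\otimes\mathcal H_{2N-1}$ whose components are the complex conjugates of the components of $|\dot{\tilde C}_{\theta,i}\rangle$ with last index $m$. Let $B$ be the matrix with columns $|c_{i,m}\rangle$ (over all $i,m$), and for an operator $S$ on $\mathcal H_1\otimes\cdots\otimes\mathcal H_{2N-2}$ and $\lambda\in\mathbb R$ let $$A(h,\lambda,S)=\begin{pmatrix}\mathbb 1_{q d_{2N}}&B^\dagger\\ B&\mathbb 1_{2N-1}\otimes\lambda S\end{pmatrix}.$$ Consider the semidefinite program: minimize $\lambda$ over $\lambda\ge0$, $h\in\mathrm{Herm}(\mathbb C^q)$ and Hermitian $S^{(k)}$ on $\mathcal H_1\otimes\cdots\otimes\mathcal H_{2k}$ ($1\le k\le N-1$; $S^{(0)}:=1$),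 subject to $\operatorname{tr}_{2k}S^{(k)}=\mathbb 1_{2k-1}\otimes S^{(k-1)}$ for $1\le k\le N-1$ and $A(h,\lambda,S^{(N-1)})\succeq0$. Then: (a) For every probe $T$ the family $t\mapsto C_t*T$ has a Hermitian $L$ as above at $\theta$, and the maximum defining $J(C_\theta)$ is attained. (b) The program attains its minimum $\lambda^*$, and $J(C_\theta)=4\lambda^*$. (c) For all $h,\lambda,S$: $A(h,\lambda,S)\succeq0$ if and only if $\mathbb 1_{2N-1}\otimes\lambda S\succeq\tfrac14\operatorname{tr}_{2N}\Omega_\theta(h)$. (d) (Strong duality.) For every Hermitian $h$ the following values are attained and equal: the maximum of $\operatorname{tr}[T(\mathbb 1_{\rm aux}\otimes\operatorname{tr}_{2N}\Omega_\theta(h))]$ over probes $T$, for any fixed nonzero finite-dimensional $\mathcal H_{\rm aux}$; the minimum of $S^{(0)}\in\mathbb R$ over Hermitian $S^{(k)}$ ($0\le k\le N-1$) with $\mathbb 1_{2k-1}\otimes S^{(k-1)}\succeq\operatorname{tr}_{2k}S^{(k)}$ for $1\le k\le N-1$ and $\mathbb 1_{2N-1}\otimes S^{(N-1)}\succeq\operatorname{tr}_{2N}\Omega_\theta(h)$;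 the same minimum with the first $N-1$ inequalities replaced by equalities; and the minimum of $4\lambda$ in the semidefinite program with $h$ held fixed. (e) For every Hermitian $h$ and every feasible point of the dual problem with inequalities in (d) there is a feasible point with the same $S^{(0)}$ for which the first $N-1$ constraints are equalities. -/

import Mathlib

open scoped Kronecker ComplexOrder

namespace QComb

noncomputable section

/-! ### Finite-dimensional spaces `H_1, …, H_k` and operators on their tensor products

`H_i` is `ℂ^(d i)`.  Operators on a tensor product are matrices indexed by the product basis. -/

/-- Indices of the product basis of `H_1 ⊗ ⋯ ⊗ H_k`, where `H_i = ℂ^(d i)`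
(the empty tensor product being `ℂ`).  The value `d 0` is never used. -/
def Idx (d : ℕ → ℕ) : ℕ → Type
  | 0 => Unit
  | k + 1 => Idx d k × Fin (d (k + 1))

instance instFintypeIdx (d : ℕ → ℕ) : ∀ k, Fintype (Idx d k)
  | 0 => inferInstanceAs (Fintype Unit)
  | k + 1 =>
    letI := instFintypeIdx d k
    inferInstanceAs (Fintype (Idx d k × Fin (d (k + 1))))

instance instDecidableEqIdx (d : ℕ → ℕ) : ∀ k, DecidableEq (Idx d k)
  | 0 => inferInstanceAs (DecidableEq Unit)
  | k + 1 =>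
    letI := instDecidableEqIdx d k
    inferInstanceAs (DecidableEq (Idx d k × Fin (d (k + 1))))

/-- Linear operators on `H_1 ⊗ ⋯ ⊗ H_k`. -/
abbrev Op (d : ℕ → ℕ) (k : ℕ) : Type := Matrix (Idx d k) (Idx d k) ℂ

/-- Partial trace over the second tensor factor. -/
def partialTrace {α β : Type} [Fintype β] (M : Matrix (α × β) (α × β) ℂ) : Matrix α α ℂ :=
  fun x y => ∑ b, M (x, b) (y, b)

/-- Partial transpose on the first tensor factor. -/
def partialTranspose {α β : Type} (M : Matrix (α × β) (α × β) ℂ) :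
    Matrix (α × β) (α × β) ℂ :=
  fun x y => M (y.1, x.2) (x.1, y.2)

/-- `tr_{k+1}`: partial trace over the last space `H_{k+1}` of `H_1 ⊗ ⋯ ⊗ H_{k+1}`. -/
def trLast (d : ℕ → ℕ) (k : ℕ) (M : Op d (k + 1)) : Op d k :=
  partialTrace (α := Idx d k) (β := Fin (d (k + 1))) M

/-- `M ↦ 𝟙_{k+1} ⊗ M`: the operator `M` on `H_1 ⊗ ⋯ ⊗ H_k`, extended by the identity of
`H_{k+1}` (which is the last tensor factor in the order of the spaces). -/
def tensorOne (d : ℕ → ℕ) (k : ℕ) (M : Op d k) : Op d (k + 1) :=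
  (M ⊗ₖ (1 : Matrix (Fin (d (k + 1))) (Fin (d (k + 1))) ℂ) :
    Matrix (Idx d k × Fin (d (k + 1))) (Idx d k × Fin (d (k + 1))) ℂ)

/-! ### Quantum combs, probes and the link product -/

/-- Quantum combs on `H_1 ⊗ ⋯ ⊗ H_k`; the last space `H_k` is always an output.
* `k = 2 N`: `Comb[(H_1,H_2),(H_3,H_4),…,(H_{2N-1},H_{2N})]`;
* `k = 2 N + 1`: `Comb[(∅,H_1),(H_2,H_3),…,(H_{2N},H_{2N+1})]`, the first input being trivial.

A positive semidefinite `C` is a comb if tracing out its last output yields `𝟙 ⊗ C'` with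
`𝟙` the identity on its last input and `C'` a comb with one tooth less
(the comb without teeth being the scalar `1`). -/
def IsComb (d : ℕ → ℕ) : ∀ k : ℕ, Op d k → Prop
  | 0, C => C = 1
  | 1, C => C.PosSemidef ∧ trLast d 0 C = 1
  | k + 2, C => C.PosSemidef ∧ ∃ C' : Op d k, IsComb d k C' ∧
      trLast d (k + 1) C = tensorOne d k C'

/-- Probes `T ∈ Comb[(∅,H_1),(H_2,H_3),…,(H_{2n},H_{2n+1} ⊗ H_aux)]`, `H_aux = ℂ^a`:
`T ⪰ 0` and the normalization equalities hold, i.e. `tr_aux T` is a comb in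
`Comb[(∅,H_1),(H_2,H_3),…,(H_{2n},H_{2n+1})]`. -/
def IsProbe (d : ℕ → ℕ) (n a : ℕ)
    (T : Matrix (Idx d (2 * n + 1) × Fin a) (Idx d (2 * n + 1) × Fin a) ℂ) : Prop :=
  T.PosSemidef ∧ IsComb d (2 * n + 1) (partialTrace T)

/-- The link product `E * F = tr_γ [(E^{T_γ} ⊗ 𝟙_α) (𝟙_β ⊗ F)]` of an operator `E` on `γ ⊗ β`
and an operator `F` on `γ ⊗ α`, where `γ` collects the common spaces. -/
def linkProduct {γ β α : Type} [Fintype γ]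
    (E : Matrix (γ × β) (γ × β) ℂ) (F : Matrix (γ × α) (γ × α) ℂ) :
    Matrix (β × α) (β × α) ℂ :=
  fun x y => ∑ g, ∑ g', partialTranspose E (g, x.1) (g', y.1) * F (g', x.2) (g, y.2)

/-- The output state `C * T` on `H_{2n+2} ⊗ H_aux` of the comb `C` fed with the probe `T`. -/
def outputState (d : ℕ → ℕ) (n a : ℕ) (C : Op d (2 * n + 2))
    (T : Matrix (Idx d (2 * n + 1) × Fin a) (Idx d (2 * n + 1) × Fin a) ℂ) :
    Matrix (Fin (d (2 * n + 2)) × Fin a) (Fin (d (2 * n + 2)) × Fin a) ℂ :=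
  linkProduct (γ := Idx d (2 * n + 1)) (β := Fin (d (2 * n + 2))) C T

/-! ### Quantum Fisher information -/

/-- `L` is a symmetric logarithmic derivative of the curve `ρ` at `θ`:
`L` is Hermitian and `dρ/dθ = (L ρ + ρ L) / 2`. -/
def IsSLD {ι : Type} [Fintype ι] (ρ : ℝ → Matrix ι ι ℂ) (θ : ℝ) (L : Matrix ι ι ℂ) : Prop :=
  L.IsHermitian ∧
    ∀ i j, HasDerivAt (fun t => ρ t i j) (((1 / 2 : ℂ) • (L * ρ θ + ρ θ * L)) i j) θ

open Classical in
/-- The quantum Fisher information `J(ρ_θ) = tr[ρ_θ L²]` with `L` a symmetric logarithmic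
derivative (the value does not depend on `L`, see `stateQFI_eq`). -/
def stateQFI {ι : Type} [Fintype ι] (ρ : ℝ → Matrix ι ι ℂ) (θ : ℝ) : ℝ :=
  if h : ∃ L, IsSLD ρ θ L then (Matrix.trace (ρ θ * (h.choose * h.choose))).re else 0

theorem IsSLD.trace_eq {ι : Type} [Fintype ι] {ρ : ℝ → Matrix ι ι ℂ} {θ : ℝ}
    {L L' : Matrix ι ι ℂ} (hL : IsSLD ρ θ L) (hL' : IsSLD ρ θ L') :
    Matrix.trace (ρ θ * (L * L)) = Matrix.trace (ρ θ * (L' * L')) := by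
  have h : L * ρ θ + ρ θ * L = L' * ρ θ + ρ θ * L' := by
    have h2 : (1 / 2 : ℂ) • (L * ρ θ + ρ θ * L) = (1 / 2 : ℂ) • (L' * ρ θ + ρ θ * L') := by
      ext i j
      exact (hL.2 i j).unique (hL'.2 i j)
    exact smul_right_injective _ (by norm_num : (1 / 2 : ℂ) ≠ 0) h2
  have e1 := congrArg (fun M => Matrix.trace (M * L)) h
  have e2 := congrArg (fun M => Matrix.trace (M * L')) h
  simp only [Matrix.add_mul, Matrix.trace_add, Matrix.mul_assoc] at e1 e2
  have c1 : Matrix.trace (L * (ρ θ * L)) = Matrix.trace (ρ θ * (L * L)) := by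
    rw [Matrix.trace_mul_comm, Matrix.mul_assoc]
  have c2 : Matrix.trace (L' * (ρ θ * L')) = Matrix.trace (ρ θ * (L' * L')) := by
    rw [Matrix.trace_mul_comm, Matrix.mul_assoc]
  have c3 : Matrix.trace (L * (ρ θ * L')) = Matrix.trace (ρ θ * (L' * L)) := by
    rw [Matrix.trace_mul_comm, Matrix.mul_assoc]
  have c4 : Matrix.trace (L' * (ρ θ * L)) = Matrix.trace (ρ θ * (L * L')) := by
    rw [Matrix.trace_mul_comm, Matrix.mul_assoc]
  rw [c1, c4] at e1
  rw [c2, c3] at e2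
  linear_combination (1 / 2 : ℂ) * e1 + (1 / 2 : ℂ) * e2

theorem stateQFI_eq {ι : Type} [Fintype ι] {ρ : ℝ → Matrix ι ι ℂ} {θ : ℝ}
    {L : Matrix ι ι ℂ} (hL : IsSLD ρ θ L) :
    stateQFI ρ θ = (Matrix.trace (ρ θ * (L * L))).re := by
  have h : ∃ L, IsSLD ρ θ L := ⟨L, hL⟩
  unfold stateQFI
  rw [dif_pos h, h.choose_spec.trace_eq hL]

/-- The values `J(C_θ * T)` for all probes `T`, with an ancilla of any finite dimension. -/
def probeQFIs (d : ℕ → ℕ) (n : ℕ) (C : ℝ → Op d (2 * n + 2)) (θ : ℝ) : Set ℝ :=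
  {x | ∃ (a : ℕ) (T : Matrix (Idx d (2 * n + 1) × Fin a) (Idx d (2 * n + 1) × Fin a) ℂ),
    IsProbe d n a T ∧ x = stateQFI (fun t => outputState d n a (C t) T) θ}

/-- The comb QFI `J(C_θ)`: the maximum over all probes `T` of `J(C_θ * T)`. -/
def combQFI (d : ℕ → ℕ) (n : ℕ) (C : ℝ → Op d (2 * n + 2)) (θ : ℝ) : ℝ :=
  sSup (probeQFIs d n C θ)

/-! ### Ensemble decompositions and the performance operator

`v i t` is the vector `|C_{t,i}⟩`, for `i` in `Fin q`. -/

/-- `|Ċ~_{θ,i}⟩ = |Ċ_{θ,i}⟩ - i ∑_j h_{ij} |C_{θ,j}⟩`. -/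
def dotVec {κ : Type} {q : ℕ} (v : Fin q → ℝ → κ → ℂ) (θ : ℝ)
    (h : Matrix (Fin q) (Fin q) ℂ) (i : Fin q) : κ → ℂ :=
  fun m => deriv (fun t => v i t m) θ - Complex.I * ∑ j, h i j * v j θ m

/-- The performance operator
`Ω_θ(h) = 4 ∑_i (|Ċ~_{θ,i}⟩⟨Ċ~_{θ,i}|)^{T_{1…2n+1}}` on `H_1 ⊗ ⋯ ⊗ H_{2n+2}`. -/
def perfOp (d : ℕ → ℕ) (n : ℕ) {q : ℕ} (v : Fin q → ℝ → Idx d (2 * n + 2) → ℂ) (θ : ℝ)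
    (h : Matrix (Fin q) (Fin q) ℂ) : Op d (2 * n + 2) :=
  (4 : ℂ) • ∑ i, partialTranspose (α := Idx d (2 * n + 1)) (β := Fin (d (2 * n + 2)))
    (Matrix.vecMulVec (dotVec v θ h i) (star (dotVec v θ h i)))

/-- `tr_{2n+2} Ω_θ(h)`. -/
def redPerfOp (d : ℕ → ℕ) (n : ℕ) {q : ℕ} (v : Fin q → ℝ → Idx d (2 * n + 2) → ℂ) (θ : ℝ)
    (h : Matrix (Fin q) (Fin q) ℂ) : Op d (2 * n + 1) :=
  trLast d (2 * n + 1) (perfOp d n v θ h)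

/-! ### The semidefinite program -/

/-- The vector `|c_{i,m}⟩` on `H_1 ⊗ ⋯ ⊗ H_{2n+1}`, whose components are the complex conjugates
of those components of `|Ċ~_{θ,i}⟩` whose last index is `m`. -/
def cVec (d : ℕ → ℕ) (n : ℕ) {q : ℕ} (v : Fin q → ℝ → Idx d (2 * n + 2) → ℂ) (θ : ℝ)
    (h : Matrix (Fin q) (Fin q) ℂ) (i : Fin q) (m : Fin (d (2 * n + 2))) :
    Idx d (2 * n + 1) → ℂ :=
  fun g => star (dotVec v θ h i ((g, m) : Idx d (2 * n + 1) × Fin (d (2 * n + 2))))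

/-- The block matrix `A(h, λ, S)`: identity of size `q * d_{2n+2}` in the upper left block,
rows `⟨c_{i,m}|` in the upper right block, columns `|c_{i,m}⟩` in the lower left block and
`𝟙_{2n+1} ⊗ λ S` in the lower right block. -/
def blockA (d : ℕ → ℕ) (n : ℕ) {q : ℕ} (v : Fin q → ℝ → Idx d (2 * n + 2) → ℂ) (θ : ℝ)
    (h : Matrix (Fin q) (Fin q) ℂ) (lam : ℝ) (S : Op d (2 * n)) :
    Matrix ((Fin q × Fin (d (2 * n + 2))) ⊕ Idx d (2 * n + 1))
      ((Fin q × Fin (d (2 * n + 2))) ⊕ Idx d (2 * n + 1)) ℂ :=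
  Matrix.fromBlocks 1
    (Matrix.of fun im g => star (cVec d n v θ h im.1 im.2 g))
    (Matrix.of fun g im => cVec d n v θ h im.1 im.2 g)
    (tensorOne d (2 * n) ((lam : ℂ) • S))

/-- Feasible points `(λ, h, (S^{(k)}))` of the semidefinite program; `S^{(0)}` is the scalar `1`
and only `S^{(1)}, …, S^{(n)}` matter. -/
structure SDPFeasible (d : ℕ → ℕ) (n : ℕ) {q : ℕ} (v : Fin q → ℝ → Idx d (2 * n + 2) → ℂ)
    (θ : ℝ) (lam : ℝ) (h : Matrix (Fin q) (Fin q) ℂ) (S : ∀ k, Op d (2 * k)) : Prop where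
  lam_nonneg : 0 ≤ lam
  h_herm : h.IsHermitian
  S_herm : ∀ k, 1 ≤ k → k ≤ n → (S k).IsHermitian
  S_zero : S 0 = 1
  S_norm : ∀ k, k < n → trLast d (2 * k + 1) (S (k + 1)) = tensorOne d (2 * k) (S k)
  block : (blockA d n v θ h lam (S n)).PosSemidef

/-- The values of the primal problem for fixed `h` and an ancilla of dimension `a`:
`tr[T (𝟙_aux ⊗ tr_{2n+2} Ω_θ(h))]` over all probes `T`. -/
def primalValues (d : ℕ → ℕ) (n a : ℕ) {q : ℕ} (v : Fin q → ℝ → Idx d (2 * n + 2) → ℂ)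
    (θ : ℝ) (h : Matrix (Fin q) (Fin q) ℂ) : Set ℝ :=
  {x | ∃ T : Matrix (Idx d (2 * n + 1) × Fin a) (Idx d (2 * n + 1) × Fin a) ℂ,
    IsProbe d n a T ∧
    x = (Matrix.trace (T * (redPerfOp d n v θ h ⊗ₖ (1 : Matrix (Fin a) (Fin a) ℂ)))).re}

/-- Feasible points `(S^{(0)}, …, S^{(n)})` of the dual problem for fixed `h`, with inequality
constraints.  `S^{(0)}` is a scalar, i.e. a `1 × 1` matrix. -/
structure DualFeasible (d : ℕ → ℕ) (n : ℕ) {q : ℕ} (v : Fin q → ℝ → Idx d (2 * n + 2) → ℂ)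
    (θ : ℝ) (h : Matrix (Fin q) (Fin q) ℂ) (S : ∀ k, Op d (2 * k)) : Prop where
  herm : ∀ k, k ≤ n → (S k).IsHermitian
  le : ∀ k, k < n →
    (tensorOne d (2 * k) (S k) - trLast d (2 * k + 1) (S (k + 1))).PosSemidef
  last : (tensorOne d (2 * n) (S n) - redPerfOp d n v θ h).PosSemidef

/-- The objective `S^{(0)}` of the dual problem, as a real number. -/
def dualObjective (d : ℕ → ℕ) (S : ∀ k, Op d (2 * k)) : ℝ :=
  (Matrix.trace (S 0)).re

/-- All constraints of the dual problem except the last one hold with equality. -/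
def DualTight (d : ℕ → ℕ) (n : ℕ) (S : ∀ k, Op d (2 * k)) : Prop :=
  ∀ k, k < n → trLast d (2 * k + 1) (S (k + 1)) = tensorOne d (2 * k) (S k)

end

end QComb

/-! Write a probe as `T = B B†`. The output state then factors as `Φ Φ†`, where the columns of `Φ`
link `B` with the vectors `|C_{t,i}⟩`. Passing from `Ċ` to `Ċ~` replaces `Φ̇` by `Y = Φ̇ - i Φ (hᵀ ⊗
1)`. For Hermitian `h` this does not change the derivative of the state, while `4 tr(Y Y†) = tr[R
tr_{2N} Ω_θ(h)]` is linear in the reduced probe `R = tr_aux T`. Expanding `‖Y - L Φ / 2‖² ≥ 0`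
bounds the Fisher information of the output by this quantity for every `h`. For a pure probe some
`h` gives equality: since the rank is constant, `Φ̇` maps `ker Φ` into `range Φ`, and hence `Φ̇ - L
Φ / 2 = i Φ H` with `H` Hermitian (`exists_hermitian_gauge`). As `B` is a single column, `H` is the
transpose of an admissible `h`.

The comb QFI is thus a max-min of `tr[R tr_{2N} Ω_θ(h)]`, which is affine in `R` on the compact
convex set of combs and convex in `h`. Sion's theorem gives a saddle point `(h₀, R₀)`. A
purification of `R₀` is an optimal probe, and mixed probes are bounded through `h₀`.

For fixed `h` the problem is linear in `R`. Reduced probes are exactly the positive `R` with `tr[R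
(𝟙 ⊗ S)] = s` for every chain `S` with `S^{(0)} = s` (`isComb_iff_trace`). Hahn–Banach separation
from the closed convex set of operators dominated by such chains then yields, for every upper bound
`p` of the primal, a dual point with equalities and value exactly `p` (`exists_chain_of_forall_le`).
This gives strong duality and (e). Rescaling by `p` and a Schur complement turn it into the
semidefinite program. -/

namespace QComb

open Matrix Filter Topology

/-! ### Quantum Fisher information of a factorized family of states -/

section Factor

variable {m k : Type} [Fintype m] [Fintype k]

/-- In an eigenbasis of `Φ Φ†` the equation for `L` decouples entrywise into `(w i + w j) L i j = 2
σ i j`. It is solvable also where `w i + w j = 0`, because rows `i` and `j` of `Φ` then vanish and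
so does `σ i j`. -/
theorem exists_sld_of_diagonal [DecidableEq m] {Φ Y : Matrix m k ℂ} {w : m → ℝ}
    (hw : Φ * Φᴴ = diagonal (fun i => (w i : ℂ))) :
    ∃ L : Matrix m m ℂ, L.IsHermitian ∧
      Y * Φᴴ + Φ * Yᴴ = (1 / 2 : ℂ) • (L * (Φ * Φᴴ) + (Φ * Φᴴ) * L) := by
  set σ := Y * Φᴴ + Φ * Yᴴ with hσ
  have hσH : σᴴ = σ := by
    simp [hσ, conjTranspose_mul, add_comm]
  have hrow : ∀ i, w i = 0 → ∀ x, Φ i x = 0 := by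
    intro i hi
    have h1 : (Φ * Φᴴ) i i = 0 := by rw [hw]; simp [hi]
    have h2 : ∑ x, Complex.normSq (Φ i x) = 0 := by
      have : ((∑ x, Complex.normSq (Φ i x) : ℝ) : ℂ) = 0 := by
        rw [← h1, mul_apply]
        push_cast
        refine Finset.sum_congr rfl fun x _ => ?_
        rw [conjTranspose_apply, ← Complex.mul_conj]; rfl
      exact_mod_cast this
    intro x
    have := (Finset.sum_eq_zero_iff_of_nonneg (fun x _ => Complex.normSq_nonneg (Φ i x))).1 h2 x
      (Finset.mem_univ x)
    exact Complex.normSq_eq_zero.1 this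
  have hw0 : ∀ i, 0 ≤ w i := by
    intro i
    have h1 := (posSemidef_self_mul_conjTranspose Φ).diag_nonneg (i := i)
    rw [hw, diagonal_apply_eq] at h1
    exact_mod_cast h1
  -- Where the denominator is zero, division returns `0`, a legitimate value since `σ i j = 0`
  -- there.
  refine ⟨of fun i j => 2 * σ i j / ((w i : ℂ) + w j), ?_, ?_⟩
  · ext i j
    have h1 : star (σ j i) = σ i j := congrFun (congrFun hσH i) j
    have h2 : star (w j : ℂ) = w j := Complex.conj_ofReal _
    have h3 : star (w i : ℂ) = w i := Complex.conj_ofReal _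
    simp only [conjTranspose_apply, of_apply, star_div₀, star_mul', star_add, h1, h2, h3]
    rw [add_comm (w j : ℂ)]
    congr 2
    simp
  · ext i j
    rw [hw]
    simp only [Matrix.smul_apply, Matrix.add_apply, mul_diagonal, diagonal_mul, of_apply, smul_eq_mul]
    by_cases h0 : (w i : ℂ) + w j = 0
    · have h1 : w i + w j = 0 := by exact_mod_cast h0
      have hi : w i = 0 := by linarith [hw0 i, hw0 j]
      have hj : w j = 0 := by linarith [hw0 i, hw0 j]
      have : σ i j = 0 := by
        simp [hσ, mul_apply, conjTranspose_apply, hrow i hi, hrow j hj]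
      simp [this]
    · field_simp
      ring

theorem exists_unitary_diagonal [DecidableEq m] {A : Matrix m m ℂ} (hA : A.IsHermitian) :
    ∃ (U : Matrix m m ℂ) (w : m → ℝ), Uᴴ * U = 1 ∧ U * Uᴴ = 1 ∧
      A = U * diagonal (fun i => (w i : ℂ)) * Uᴴ := by
  refine ⟨hA.eigenvectorUnitary, hA.eigenvalues, ?_, ?_, ?_⟩
  · exact Unitary.coe_star_mul_self _
  · exact Unitary.coe_mul_star_self _
  · conv_lhs => rw [hA.spectral_theorem, Unitary.conjStarAlgAut_apply]
    rfl

/-- A symmetric logarithmic derivative exists for every tangent vector of the form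
`Y Φ† + Φ Y†` at `Φ Φ†`. -/
theorem exists_sld_of_factor (Φ Y : Matrix m k ℂ) :
    ∃ L : Matrix m m ℂ, L.IsHermitian ∧
      Y * Φᴴ + Φ * Yᴴ = (1 / 2 : ℂ) • (L * (Φ * Φᴴ) + (Φ * Φᴴ) * L) := by
  classical
  obtain ⟨U, w, h1, h2, h3⟩ := exists_unitary_diagonal (isHermitian_mul_conjTranspose_self Φ)
  have key : (Uᴴ * Φ) * (Uᴴ * Φ)ᴴ = diagonal (fun i => (w i : ℂ)) := by
    calc (Uᴴ * Φ) * (Uᴴ * Φ)ᴴ = Uᴴ * (Φ * Φᴴ) * U := by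
          simp [conjTranspose_mul, Matrix.mul_assoc]
      _ = (Uᴴ * U) * diagonal (fun i => (w i : ℂ)) * (Uᴴ * U) := by
          rw [h3]; simp only [Matrix.mul_assoc]
      _ = _ := by simp [h1]
  obtain ⟨L, hL, hL2⟩ := exists_sld_of_diagonal (Y := Uᴴ * Y) key
  refine ⟨U * L * Uᴴ, isHermitian_mul_mul_conjTranspose U hL, ?_⟩
  have e := congrArg (fun M => U * M * Uᴴ) hL2
  have c : ∀ M : Matrix m m ℂ, U * (Uᴴ * M) = M := fun M => by
    rw [← Matrix.mul_assoc, h2, Matrix.one_mul]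
  simp only [conjTranspose_mul, conjTranspose_conjTranspose, Matrix.mul_add, Matrix.add_mul,
    Matrix.mul_smul, Matrix.smul_mul, Matrix.mul_assoc, h2, Matrix.mul_one, c] at e ⊢
  exact e

/-- A Hermitian generalized inverse of `Φ Φ†`. -/
theorem exists_hermitian_pinv (Φ : Matrix m k ℂ) :
    ∃ G : Matrix m m ℂ, G.IsHermitian ∧ Φ * Φᴴ * G * Φ = Φ := by
  classical
  obtain ⟨U, w, h1, h2, h3⟩ := exists_unitary_diagonal (isHermitian_mul_conjTranspose_self Φ)
  set D := diagonal (fun i => (w i : ℂ)) with hD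
  set E := diagonal (fun i => (((w i)⁻¹ : ℝ) : ℂ)) with hE
  have hEH : E.IsHermitian := by
    rw [hE, IsHermitian, diagonal_conjTranspose]
    congr 1
    ext i
    exact Complex.conj_ofReal _
  refine ⟨U * E * Uᴴ, isHermitian_mul_mul_conjTranspose U hEH, ?_⟩
  set G := U * E * Uᴴ with hG
  have hDED : D * E * D = D := by
    rw [hD, hE, diagonal_mul_diagonal, diagonal_mul_diagonal]
    congr 1
    ext i
    rcases eq_or_ne (w i) 0 with h | h
    · simp [h]
    · push_cast
      have : (w i : ℂ) ≠ 0 := by exact_mod_cast h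
      field_simp
  have hρ : Φ * Φᴴ * G * (Φ * Φᴴ) = Φ * Φᴴ := by
    rw [h3, hG]
    calc U * D * Uᴴ * (U * E * Uᴴ) * (U * D * Uᴴ)
        = U * D * (Uᴴ * U) * E * (Uᴴ * U) * D * Uᴴ := by simp only [Matrix.mul_assoc]
      _ = U * (D * E * D) * Uᴴ := by simp only [h1, Matrix.mul_one, Matrix.mul_assoc]
      _ = _ := by rw [hDED]
  have hz : (Φ * Φᴴ * G - 1) * Φ = 0 := by
    rw [← self_mul_conjTranspose_eq_zero, conjTranspose_mul, ← Matrix.mul_assoc,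
      Matrix.mul_assoc _ Φ, Matrix.sub_mul, hρ]
    simp
  rwa [Matrix.sub_mul, Matrix.one_mul, sub_eq_zero] at hz

/-- `Q` is the orthogonal projection onto the complement of `ker Φ`. The hypothesis on `X` makes `Z
* Q` anti-Hermitian, and the remaining block of `Z` can be balanced by a term that `Φ` annihilates.
-/
theorem exists_antihermitian_of_mul [DecidableEq k] {Φ X : Matrix m k ℂ}
    (hX : X * Φᴴ + Φ * Xᴴ = 0) (hr : ∃ Z : Matrix k k ℂ, X = Φ * Z) :
    ∃ Z : Matrix k k ℂ, Zᴴ = -Z ∧ X = Φ * Z := by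
  obtain ⟨Z₀, hZ₀⟩ := hr
  obtain ⟨G, hG, hGΦ⟩ := exists_hermitian_pinv Φ
  set Q := Φᴴ * G * Φ with hQ
  have hQH : Qᴴ = Q := by
    simp [hQ, conjTranspose_mul, hG.eq, Matrix.mul_assoc]
  set Z := Φᴴ * G * X with hZ
  have hΦQ : Φ * Q = Φ := by
    rw [hQ]; simpa only [Matrix.mul_assoc] using hGΦ
  have hΦZ : Φ * Z = X := by
    rw [hZ, hZ₀]
    have : Φ * (Φᴴ * G * (Φ * Z₀)) = (Φ * Φᴴ * G * Φ) * Z₀ := by simp only [Matrix.mul_assoc]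
    rw [this, hGΦ]
  have hZQ : Z * Q + Q * Zᴴ = 0 := by
    have : Z * Q + Q * Zᴴ = Φᴴ * G * (X * Φᴴ + Φ * Xᴴ) * (G * Φ) := by
      simp [hQ, hZ, conjTranspose_mul, hG.eq, Matrix.mul_add, Matrix.add_mul, Matrix.mul_assoc]
    rw [this, hX]; simp
  -- `Φ * (1 - Q) = 0`, so the correction leaves the product with `Φ` unchanged.
  refine ⟨Z - (1 - Q) * Zᴴ, ?_, ?_⟩
  · rw [conjTranspose_sub, conjTranspose_mul _ Zᴴ, conjTranspose_sub, hQH, conjTranspose_one,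
      conjTranspose_conjTranspose, Matrix.mul_sub, Matrix.mul_one, Matrix.sub_mul, Matrix.one_mul]
    have : Q * Zᴴ = - (Z * Q) := by rw [eq_neg_iff_add_eq_zero, add_comm]; exact hZQ
    rw [this]
    abel
  · rw [Matrix.mul_sub, hΦZ, ← Matrix.mul_assoc, Matrix.mul_sub, hΦQ]
    simp

/-- If the tangent vector `Φ'` maps the kernel of `Φ` into the range of `Φ`, the horizontal part
of `Φ'` is generated by the symmetric logarithmic derivative. -/
theorem exists_hermitian_gauge [DecidableEq k] {Φ D : Matrix m k ℂ} {L : Matrix m m ℂ}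
    (hL : L.IsHermitian)
    (hLD : D * Φᴴ + Φ * Dᴴ = (1 / 2 : ℂ) • (L * (Φ * Φᴴ) + (Φ * Φᴴ) * L))
    (hker : ∀ u, Φ *ᵥ u = 0 → ∃ z, D *ᵥ u = Φ *ᵥ z) :
    ∃ H : Matrix k k ℂ, H.IsHermitian ∧ D - Complex.I • (Φ * H) = (1 / 2 : ℂ) • (L * Φ) := by
  set X := D - (1 / 2 : ℂ) • (L * Φ) with hXdef
  have hX : X * Φᴴ + Φ * Xᴴ = 0 := by
    have h2 : star (2⁻¹ : ℂ) = 2⁻¹ := by simp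
    have : X * Φᴴ + Φ * Xᴴ = (D * Φᴴ + Φ * Dᴴ)
        - (1 / 2 : ℂ) • (L * (Φ * Φᴴ) + (Φ * Φᴴ) * L) := by
      simp only [hXdef, conjTranspose_sub, conjTranspose_smul, conjTranspose_mul, hL.eq,
        Matrix.sub_mul, Matrix.mul_sub, Matrix.smul_mul, Matrix.mul_smul, one_div, h2, smul_add,
        Matrix.mul_assoc]
      abel
    rw [this, hLD, sub_self]
  obtain ⟨G, hG, hGΦ⟩ := exists_hermitian_pinv Φ
  have hr : ∃ Z : Matrix k k ℂ, X = Φ * Z := by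
    have hXu : ∀ u, Φ *ᵥ u = 0 → ∃ z, X *ᵥ u = Φ *ᵥ z := by
      intro u hu
      obtain ⟨z, hz⟩ := hker u hu
      refine ⟨z, ?_⟩
      rw [hXdef, sub_mulVec, hz, smul_mulVec, ← mulVec_mulVec, hu]
      simp
    -- The range of `X` lies in that of `Φ`: split a basis vector `e` into `e - p` in `ker Φ`,
    -- covered by `hker`, and `p` in the range of `Φ†`, where `X Φ† = -Φ X†` applies.
    have hXP : Φ * Φᴴ * G * X = X := by
      apply Matrix.ext_of_mulVec_single
      intro i
      set e : k → ℂ := Pi.single i 1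
      set p := Φᴴ *ᵥ (G *ᵥ (Φ *ᵥ e)) with hp
      have hΦp : Φ *ᵥ (e - p) = 0 := by
        rw [mulVec_sub, hp]
        simp only [mulVec_mulVec, ← Matrix.mul_assoc]
        rw [hGΦ, sub_self]
      obtain ⟨z, hz⟩ := hXu _ hΦp
      have hXp : X *ᵥ p = Φ *ᵥ (- (Xᴴ *ᵥ (G *ᵥ (Φ *ᵥ e)))) := by
        have h1 : X * Φᴴ = - (Φ * Xᴴ) := eq_neg_of_add_eq_zero_left hX
        rw [hp, mulVec_mulVec, h1, neg_mulVec, mulVec_neg, ← mulVec_mulVec]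
      have hXe : X *ᵥ e = Φ *ᵥ (z - (Xᴴ *ᵥ (G *ᵥ (Φ *ᵥ e)))) := by
        have : e = (e - p) + p := by abel
        rw [this, mulVec_add, hz, hXp, ← mulVec_add, ← this, sub_eq_add_neg]
      rw [← mulVec_mulVec, hXe, mulVec_mulVec, hGΦ]
    refine ⟨Φᴴ * G * X, ?_⟩
    rw [← Matrix.mul_assoc, ← Matrix.mul_assoc, hXP]
  obtain ⟨Z, hZ, hXZ⟩ := exists_antihermitian_of_mul hX hr
  refine ⟨-Complex.I • Z, ?_, ?_⟩
  · rw [IsHermitian, conjTranspose_smul, hZ]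
    simp
  · rw [Matrix.mul_smul, ← hXZ, smul_smul]
    simp [hXdef]

theorem trace_sld_sq_eq {Φ Y : Matrix m k ℂ} {L : Matrix m m ℂ} (hL : L.IsHermitian)
    (hY : Y = (1 / 2 : ℂ) • (L * Φ)) :
    (trace (Φ * Φᴴ * (L * L))).re = 4 * (trace (Y * Yᴴ)).re := by
  have h2 : star (2⁻¹ : ℂ) = 2⁻¹ := by simp
  have : trace (Y * Yᴴ) = (1 / 4 : ℂ) * trace (Φ * Φᴴ * (L * L)) := by
    rw [hY]
    simp only [conjTranspose_smul, conjTranspose_mul, hL.eq, Matrix.smul_mul, Matrix.mul_smul,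
      one_div, h2, trace_smul, smul_eq_mul]
    rw [Matrix.mul_assoc, trace_mul_comm]
    simp only [Matrix.mul_assoc]
    ring
  rw [this]
  have : (1 / 4 : ℂ) = ((1 / 4 : ℝ) : ℂ) := by norm_num
  rw [this, Complex.re_ofReal_mul]
  ring

/-- Expand `‖Y - L Φ / 2‖² ≥ 0`. Multiplying the equation for `L` by `L` and taking the trace
evaluates the cross terms, leaving `tr(Y Y†) - tr(Φ Φ† L²) / 4`. -/
theorem trace_sld_sq_le {Φ Y : Matrix m k ℂ} {L : Matrix m m ℂ} (hL : L.IsHermitian)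
    (hLY : Y * Φᴴ + Φ * Yᴴ = (1 / 2 : ℂ) • (L * (Φ * Φᴴ) + (Φ * Φᴴ) * L)) :
    (trace (Φ * Φᴴ * (L * L))).re ≤ 4 * (trace (Y * Yᴴ)).re := by
  have h2 : star (2⁻¹ : ℂ) = 2⁻¹ := by simp
  have hpos : 0 ≤ (trace ((Y - (1 / 2 : ℂ) • (L * Φ)) * (Y - (1 / 2 : ℂ) • (L * Φ))ᴴ)).re :=
    (Complex.le_def.1 (posSemidef_self_mul_conjTranspose (Y - (1 / 2 : ℂ) • (L * Φ))).trace_nonneg).1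
  have e1 := congrArg (fun M => trace (M * L)) hLY
  simp only [Matrix.add_mul, Matrix.smul_mul, trace_add, trace_smul, smul_eq_mul] at e1
  have c1 : trace (L * (Φ * Φᴴ) * L) = trace (Φ * Φᴴ * (L * L)) := by
    rw [Matrix.mul_assoc, trace_mul_comm, Matrix.mul_assoc]
  have c2 : trace (Φ * Φᴴ * L * L) = trace (Φ * Φᴴ * (L * L)) := by
    rw [Matrix.mul_assoc]
  rw [c1, c2] at e1
  have c3 : trace ((Y - (1 / 2 : ℂ) • (L * Φ)) * (Y - (1 / 2 : ℂ) • (L * Φ))ᴴ) =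
      trace (Y * Yᴴ) - (1 / 2 : ℂ) * (trace (Y * Φᴴ * L) + trace (Φ * Yᴴ * L))
        + (1 / 4 : ℂ) * trace (Φ * Φᴴ * (L * L)) := by
    simp only [conjTranspose_sub, conjTranspose_smul, conjTranspose_mul, hL.eq, Matrix.sub_mul,
      Matrix.mul_sub, Matrix.smul_mul, Matrix.mul_smul, one_div, h2, trace_sub, trace_smul,
      smul_eq_mul]
    have d1 : trace (L * Φ * Yᴴ) = trace (Φ * Yᴴ * L) := by
      rw [Matrix.mul_assoc, trace_mul_comm]
    have d2 : trace (L * Φ * (Φᴴ * L)) = trace (Φ * Φᴴ * (L * L)) := by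
      rw [Matrix.mul_assoc, trace_mul_comm]; simp only [Matrix.mul_assoc]
    rw [d1, d2, ← Matrix.mul_assoc]
    ring
  rw [c3, e1] at hpos
  have c4 : ∀ a b : ℂ, a - (1 / 2 : ℂ) * ((1 / 2 : ℂ) * (b + b)) + (1 / 4 : ℂ) * b
      = a - ((1 / 4 : ℝ) : ℂ) * b := by
    intro a b; push_cast; ring
  rw [mul_add, ← mul_add, c4, Complex.sub_re, Complex.re_ofReal_mul] at hpos
  linarith

end Factor

/-! ### Tangent directions of matrix curves under a rank bound -/

section Rank

variable {m k : Type} [Fintype m] [Fintype k]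

/-- The derivative of a matrix curve whose rank does not exceed its value at `θ` maps the kernel
at `θ` into the range. -/
theorem deriv_mulVec_mem_range_of_rank_le {Φ : ℝ → Matrix m k ℂ} {D : Matrix m k ℂ} {θ : ℝ}
    (hD : ∀ i j, HasDerivAt (fun t => Φ t i j) (D i j) θ)
    (hr : ∀ᶠ t in 𝓝 θ, (Φ t).rank ≤ (Φ θ).rank) (u : k → ℂ) (hu : Φ θ *ᵥ u = 0) :
    ∃ z, D *ᵥ u = Φ θ *ᵥ z := by
  classical
  by_contra hcon
  push Not at hcon
  set r := (Φ θ).rank with hrdef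
  let b := Module.finBasis ℂ (LinearMap.range (Φ θ).mulVecLin)
  have hcard : Module.finrank ℂ (LinearMap.range (Φ θ).mulVecLin) = r := rfl
  have hex : ∀ i, ∃ z, Φ θ *ᵥ z = (b i : m → ℂ) := fun i => by
    obtain ⟨z, hz⟩ := (b i).2
    exact ⟨z, hz⟩
  choose z hz using hex
  -- If `D u` were outside the range, these `r + 1` vectors in the range of `Φ t` would tend to an
  -- independent family: the slot `none` is a difference quotient, because `Φ θ u = 0`. Independence
  -- is an open condition, so the rank would exceed `r` near `θ`.
  let F : ℝ → Option (Fin (Module.finrank ℂ (LinearMap.range (Φ θ).mulVecLin))) → m → ℂ :=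
    fun t o => o.elim (((t - θ : ℝ) : ℂ)⁻¹ • (Φ t *ᵥ u)) (fun i => Φ t *ᵥ z i)
  let F₀ : Option (Fin (Module.finrank ℂ (LinearMap.range (Φ θ).mulVecLin))) → m → ℂ :=
    fun o => o.elim (D *ᵥ u) (fun i => (b i : m → ℂ))
  have hli : LinearIndependent ℂ F₀ := by
    rw [linearIndependent_option]
    refine ⟨?_, ?_⟩
    · have := b.linearIndependent.map' (Submodule.subtype _) (Submodule.ker_subtype _)
      exact this
    · intro hmem
      have hle : Submodule.span ℂ (Set.range fun i => F₀ (some i)) ≤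
          LinearMap.range (Φ θ).mulVecLin := by
        rw [Submodule.span_le]
        rintro _ ⟨i, rfl⟩
        exact (b i).2
      obtain ⟨y, hy⟩ := hle hmem
      exact hcon y hy.symm
  have hmv : ∀ y : k → ℂ, ∀ i, HasDerivAt (fun t => (Φ t *ᵥ y) i) ((D *ᵥ y) i) θ := by
    intro y i
    simp only [mulVec, dotProduct]
    exact HasDerivAt.fun_sum fun j _ => (hD i j).mul_const (y j)
  have hF : Tendsto F (𝓝[≠] θ) (𝓝 F₀) := by
    rw [tendsto_pi_nhds]
    intro o
    rw [tendsto_pi_nhds]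
    intro i
    cases o with
    | none =>
      have h1 := hasDerivAt_iff_tendsto_slope.1 (hmv u i)
      refine h1.congr fun t => ?_
      simp only [slope, F, Option.elim, hu]
      simp
    | some j =>
      have h1 := (hmv (z j) i).continuousAt.tendsto
      rw [hz j] at h1
      exact h1.mono_left nhdsWithin_le_nhds
  have hev := hF.eventually hli.eventually
  obtain ⟨t, ht⟩ := (hev.and (hr.filter_mono nhdsWithin_le_nhds)).exists
  have hsub : ∀ o, F t o ∈ LinearMap.range (Φ t).mulVecLin := by
    intro o
    cases o with
    | none => exact ⟨((t - θ : ℝ) : ℂ)⁻¹ • u, by simp [F]⟩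
    | some i => exact ⟨z i, rfl⟩
  have hli' : LinearIndependent ℂ (fun o => (⟨F t o, hsub o⟩ : LinearMap.range (Φ t).mulVecLin)) := by
    apply LinearIndependent.of_comp (Submodule.subtype _)
    exact ht.1
  have := hli'.fintype_card_le_finrank
  rw [Fintype.card_option, Fintype.card_fin, hcard] at this
  have h3 : (Φ t).rank ≤ r := ht.2
  have h4 : Module.finrank ℂ (LinearMap.range (Φ t).mulVecLin) = (Φ t).rank := rfl
  omega

end Rank

/-! ### Positive semidefinite matrices -/

section PosSemidef

variable {ι : Type} [Fintype ι]

theorem _root_.Matrix.PosSemidef.trace_mul_re_nonneg {A B : Matrix ι ι ℂ} (hA : A.PosSemidef)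
    (hB : B.PosSemidef) : 0 ≤ (trace (A * B)).re := by
  classical
  obtain ⟨X, rfl⟩ : ∃ X : Matrix ι ι ℂ, A = Xᴴ * X := by
    open scoped MatrixOrder in
    simpa [star_eq_conjTranspose] using CStarAlgebra.nonneg_iff_eq_star_mul_self.1 hA.nonneg
  rw [Matrix.mul_assoc, trace_mul_comm]
  exact (Complex.le_def.1 (hB.mul_mul_conjTranspose_same X).trace_nonneg).1

theorem _root_.Matrix.PosSemidef.trace_mul_re_le {R A B : Matrix ι ι ℂ} (hR : R.PosSemidef)
    (h : (B - A).PosSemidef) : (trace (R * A)).re ≤ (trace (R * B)).re := by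
  have := hR.trace_mul_re_nonneg h
  rw [Matrix.mul_sub, trace_sub, Complex.sub_re] at this
  linarith

theorem _root_.Matrix.PosSemidef.norm_apply_le_trace {M : Matrix ι ι ℂ} (hM : M.PosSemidef)
    (i j : ι) : ‖M i j‖ ≤ (trace M).re := by
  classical
  obtain ⟨X, rfl⟩ : ∃ X : Matrix ι ι ℂ, M = Xᴴ * X := by
    open scoped MatrixOrder in
    simpa [star_eq_conjTranspose] using CStarAlgebra.nonneg_iff_eq_star_mul_self.1 hM.nonneg
  have htr : (trace (Xᴴ * X)).re = ∑ k, ∑ l, ‖X k l‖ ^ 2 := by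
    rw [Finset.sum_comm, trace, Complex.re_sum]
    refine Finset.sum_congr rfl fun l _ => ?_
    rw [diag_apply, mul_apply, Complex.re_sum]
    refine Finset.sum_congr rfl fun k _ => ?_
    rw [conjTranspose_apply, ← Complex.normSq_eq_norm_sq]
    simp [Complex.normSq_apply]
  rw [htr, mul_apply]
  refine (norm_sum_le _ _).trans (Finset.sum_le_sum fun k _ => ?_)
  rw [norm_mul, conjTranspose_apply, norm_star]
  have hle : ∀ l, ‖X k l‖ ^ 2 ≤ ∑ l, ‖X k l‖ ^ 2 := fun l =>
    Finset.single_le_sum (f := fun l => ‖X k l‖ ^ 2) (fun _ _ => by positivity) (Finset.mem_univ l)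
  nlinarith [hle i, hle j, sq_nonneg (‖X k i‖ - ‖X k j‖)]

theorem isClosed_posSemidef : IsClosed {M : Matrix ι ι ℂ | M.PosSemidef} := by
  have : {M : Matrix ι ι ℂ | M.PosSemidef} =
      {M | Mᴴ = M} ∩ ⋂ x : ι → ℂ, {M | 0 ≤ star x ⬝ᵥ (M *ᵥ x)} := by
    ext M
    simp only [Set.mem_ofPred_eq, Set.mem_inter_iff, Set.mem_iInter]
    exact posSemidef_iff_dotProduct_mulVec
  rw [this]
  refine (isClosed_eq (by fun_prop) continuous_id).inter (isClosed_iInter fun x => ?_)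
  have h : ∀ M : Matrix ι ι ℂ, 0 ≤ star x ⬝ᵥ (M *ᵥ x) ↔
      0 ≤ (star x ⬝ᵥ (M *ᵥ x)).re ∧ 0 = (star x ⬝ᵥ (M *ᵥ x)).im := fun M => Complex.le_def
  simp only [h]
  have hc : Continuous fun M : Matrix ι ι ℂ => star x ⬝ᵥ (M *ᵥ x) := by fun_prop
  exact (isClosed_le continuous_const (Complex.continuous_re.comp hc)).inter
    (isClosed_eq continuous_const (Complex.continuous_im.comp hc))

theorem exists_trace_repr (f : Matrix ι ι ℂ →ₗ[ℝ] ℝ) :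
    ∃ R : Matrix ι ι ℂ, ∀ X, f X = (trace (R * X)).re := by
  classical
  -- `f` is only real-linear, so each complex coefficient is assembled from the values of `f` on a
  -- matrix unit and on `i` times it.
  refine ⟨of fun i j => (f (single j i 1) : ℂ) - Complex.I * f (single j i Complex.I), fun X => ?_⟩
  have key : ∀ i j (z : ℂ), f (single j i z) =
      (((f (single j i 1) : ℂ) - Complex.I * f (single j i Complex.I)) * z).re := by
    intro i j z
    have : single j i z = z.re • (single j i (1 : ℂ)) + z.im • single j i Complex.I := by
      rw [smul_single, smul_single, ← single_add]
      congr 1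
      simp
    rw [this, map_add, map_smul, map_smul]
    simp
    ring
  conv_lhs => rw [matrix_eq_sum_single X]
  simp only [map_sum]
  rw [Finset.sum_comm, trace, Complex.re_sum]
  refine Finset.sum_congr rfl fun i _ => ?_
  rw [diag_apply, mul_apply, Complex.re_sum]
  refine Finset.sum_congr rfl fun j _ => ?_
  rw [key]
  rfl

theorem _root_.Matrix.IsHermitian.trace_mul_eq_re {A B : Matrix ι ι ℂ} (hA : A.IsHermitian)
    (hB : B.IsHermitian) : trace (A * B) = ((trace (A * B)).re : ℂ) := by
  have : star (trace (A * B)) = trace (A * B) := by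
    rw [← trace_conjTranspose, conjTranspose_mul, hA.eq, hB.eq, trace_mul_comm]
  exact (Complex.conj_eq_iff_re.1 this).symm

omit [Fintype ι] in
theorem _root_.Matrix.IsHermitian.real_smul {A : Matrix ι ι ℂ} (hA : A.IsHermitian) (r : ℝ) :
    ((r : ℂ) • A).IsHermitian := by
  rw [IsHermitian, conjTranspose_smul, hA.eq]
  congr 1
  exact Complex.conj_ofReal r

omit [Fintype ι] in
theorem _root_.Matrix.PosSemidef.real_smul {A : Matrix ι ι ℂ} (hA : A.PosSemidef) {r : ℝ}
    (hr : 0 ≤ r) : ((r : ℂ) • A).PosSemidef :=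
  hA.smul (by exact_mod_cast hr)

end PosSemidef

/-! ### Partial traces -/

section PartialTrace

variable {α β : Type} [Fintype α] [Fintype β]

theorem trace_mul_kronecker_one [DecidableEq β] (M : Matrix (α × β) (α × β) ℂ)
    (S : Matrix α α ℂ) :
    trace (M * (S ⊗ₖ (1 : Matrix β β ℂ))) = trace (partialTrace M * S) := by
  simp only [trace, diag_apply, mul_apply, partialTrace, Fintype.sum_prod_type, kroneckerMap_apply,
    one_apply, mul_ite, mul_one, mul_zero, Finset.sum_ite_eq', Finset.mem_univ, if_true,
    Finset.sum_mul]
  refine Finset.sum_congr rfl fun x _ => ?_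
  rw [Finset.sum_comm]

omit [Fintype α] in
theorem posSemidef_partialTrace {M : Matrix (α × β) (α × β) ℂ} (hM : M.PosSemidef) :
    (partialTrace M).PosSemidef := by
  have : partialTrace M = ∑ b, M.submatrix (fun x => (x, b)) (fun x => (x, b)) := by
    ext x y
    simp [partialTrace, Matrix.sum_apply]
  rw [this]
  exact posSemidef_sum _ fun b _ => hM.submatrix _

end PartialTrace

/-! ### Tracing out and adjoining the last tensor factor -/

section Idx

variable {d : ℕ → ℕ} {k : ℕ}

theorem trLast_apply (M : Op d (k + 1)) (x y : Idx d k) :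
    trLast d k M x y = ∑ b : Fin (d (k + 1)), M (x, b) (y, b) := rfl

theorem tensorOne_apply (M : Op d k) (x y : Idx d k) (b c : Fin (d (k + 1))) :
    tensorOne d k M (x, b) (y, c) = M x y * (1 : Matrix _ _ ℂ) b c := rfl

theorem trace_mul_tensorOne (R : Op d (k + 1)) (S : Op d k) :
    trace (R * tensorOne d k S) = trace (trLast d k R * S) :=
  trace_mul_kronecker_one (α := Idx d k) (β := Fin (d (k + 1))) R S

theorem trace_tensorOne_mul (R : Op d (k + 1)) (S : Op d k) :
    trace (tensorOne d k S * R) = trace (S * trLast d k R) := by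
  rw [trace_mul_comm, trace_mul_tensorOne, trace_mul_comm]

theorem trLast_add (M M' : Op d (k + 1)) :
    trLast d k (M + M') = trLast d k M + trLast d k M' := by
  ext x y
  rw [Matrix.add_apply, trLast_apply, trLast_apply, trLast_apply, ← Finset.sum_add_distrib]
  rfl

theorem trLast_sub (M M' : Op d (k + 1)) :
    trLast d k (M - M') = trLast d k M - trLast d k M' := by
  ext x y
  rw [Matrix.sub_apply, trLast_apply, trLast_apply, trLast_apply, ← Finset.sum_sub_distrib]
  rfl

theorem trLast_smul (c : ℂ) (M : Op d (k + 1)) : trLast d k (c • M) = c • trLast d k M := by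
  ext x y
  exact (Finset.mul_sum Finset.univ (fun b : Fin (d (k + 1)) => M (x, b) (y, b)) c).symm

theorem trLast_zero : trLast d k 0 = 0 := by
  simpa using trLast_smul (d := d) (k := k) 0 0

theorem tensorOne_add (M M' : Op d k) :
    tensorOne d k (M + M') = tensorOne d k M + tensorOne d k M' :=
  Matrix.add_kronecker _ _ _

theorem tensorOne_smul (c : ℂ) (M : Op d k) : tensorOne d k (c • M) = c • tensorOne d k M :=
  Matrix.smul_kronecker _ _ _

theorem tensorOne_one : tensorOne d k 1 = 1 :=
  one_kronecker_one (m := Idx d k) (n := Fin (d (k + 1)))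

theorem trLast_tensorOne (M : Op d k) :
    trLast d k (tensorOne d k M) = (d (k + 1) : ℂ) • M := by
  ext x y
  simp [trLast_apply, tensorOne_apply]

theorem isHermitian_tensorOne {M : Op d k} (hM : M.IsHermitian) :
    (tensorOne d k M).IsHermitian := by
  rw [IsHermitian, tensorOne]
  exact (conjTranspose_kronecker M (1 : Matrix (Fin (d (k + 1))) (Fin (d (k + 1))) ℂ)).trans
    (by rw [hM.eq, conjTranspose_one])

theorem posSemidef_trLast {M : Op d (k + 1)} (hM : M.PosSemidef) : (trLast d k M).PosSemidef :=
  posSemidef_partialTrace (α := Idx d k) (β := Fin (d (k + 1))) hM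

theorem continuous_tensorOne : Continuous (tensorOne d k) := by
  refine continuous_pi fun x => continuous_pi fun y => ?_
  have : (fun M : Op d k => tensorOne d k M x y) =
      fun M => M x.1 y.1 * (1 : Matrix _ _ ℂ) x.2 y.2 := rfl
  rw [this]
  fun_prop

end Idx

/-! ### Chains of normalized operators -/

/-- `S` on `H_1 ⊗ ⋯ ⊗ H_{2n}` is the last member `S^{(n)}` of a chain of Hermitian operators with
`tr_{2k} S^{(k)} = 𝟙_{2k-1} ⊗ S^{(k-1)}` and `S^{(0)} = s`. -/
def Chain (d : ℕ → ℕ) : ∀ n : ℕ, Op d (2 * n) → ℝ → Prop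
  | 0, S, s => S = (s : ℂ) • (1 : Op d 0)
  | n + 1, S, s => S.IsHermitian ∧ ∃ S' : Op d (2 * n), Chain d n S' s ∧
      trLast d (2 * n + 1) S = tensorOne d (2 * n) S'

section Chain

variable {d : ℕ → ℕ} {n : ℕ} {S S' : Op d (2 * n)} {s s' : ℝ}

theorem Chain.isHermitian (h : Chain d n S s) : S.IsHermitian := by
  cases n with
  | zero =>
    have h' : S = (s : ℂ) • (1 : Op d 0) := h
    rw [h']
    exact (isHermitian_one (n := Idx d 0)).real_smul s
  | succ n => exact h.1

theorem Chain.add (h : Chain d n S s) (h' : Chain d n S' s') :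
    Chain d n (S + S') (s + s') := by
  induction n with
  | zero =>
    have e : S = (s : ℂ) • (1 : Op d 0) := h
    have e' : S' = (s' : ℂ) • (1 : Op d 0) := h'
    change S + S' = ((s + s' : ℝ) : ℂ) • (1 : Op d 0)
    rw [e, e', Complex.ofReal_add, add_smul]
  | succ n ih =>
    obtain ⟨h1, T, hT, hT2⟩ := h
    obtain ⟨h1', T', hT', hT2'⟩ := h'
    exact ⟨h1.add h1', T + T', ih hT hT', by
      rw [tensorOne_add, ← hT2, ← hT2']; exact trLast_add S S'⟩

theorem Chain.smul (h : Chain d n S s) (r : ℝ) : Chain d n ((r : ℂ) • S) (r * s) := by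
  induction n with
  | zero =>
    have e : S = (s : ℂ) • (1 : Op d 0) := h
    change (r : ℂ) • S = ((r * s : ℝ) : ℂ) • (1 : Op d 0)
    rw [e, Complex.ofReal_mul, mul_smul]
  | succ n ih =>
    obtain ⟨h1, T, hT, hT2⟩ := h
    exact ⟨h1.real_smul r, (r : ℂ) • T, ih hT, by
      rw [tensorOne_smul, ← hT2]; exact trLast_smul (r : ℂ) S⟩

variable (d n) in
theorem exists_chain_one (hd : ∀ i, 0 < d i) :
    ∃ c : ℝ, 0 < c ∧ Chain d n ((c : ℂ) • 1) 1 := by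
  induction n with
  | zero => exact ⟨1, one_pos, rfl⟩
  | succ n ih =>
    obtain ⟨c, hc, h⟩ := ih
    have hd' : (0 : ℝ) < d (2 * n + 2) := by exact_mod_cast hd _
    refine ⟨c / d (2 * n + 2), by positivity, (isHermitian_one).real_smul _, _, h, ?_⟩
    have h1 : (1 : Op d (2 * n + 2)) = tensorOne d (2 * n + 1) 1 := tensorOne_one.symm
    change trLast d (2 * n + 1) (((c / d (2 * n + 2) : ℝ) : ℂ) • (1 : Op d (2 * n + 2))) = _
    rw [trLast_smul, h1, trLast_tensorOne, tensorOne_smul, tensorOne_one, smul_smul]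
    congr 1
    have : (d (2 * n + 2) : ℂ) ≠ 0 := by exact_mod_cast hd'.ne'
    push_cast
    field_simp

/-- The pairs `(S, s)` form a real subspace of a finite-dimensional space, hence a closed set, and
the set in question is a slice of it. -/
theorem isClosed_chain (s : ℝ) : IsClosed {S : Op d (2 * n) | Chain d n S s} := by
  let V : Submodule ℝ (Op d (2 * n) × ℝ) :=
    { carrier := {x | Chain d n x.1 x.2}
      add_mem' := fun h h' => Chain.add h h'
      zero_mem' := by
        obtain ⟨S, s, h⟩ : ∃ S s, Chain d n S s := by
          induction n with
          | zero => exact ⟨_, 0, rfl⟩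
          | succ n ih =>
            obtain ⟨S, s, h⟩ := ih
            refine ⟨0, 0, isHermitian_zero, (0 : ℝ) • S, ?_, ?_⟩
            · simpa using h.smul 0
            · have : tensorOne d (2 * n) ((0 : ℂ) • S) = 0 := by rw [tensorOne_smul, zero_smul]
              rw [zero_smul] at this ⊢
              rw [this]
              exact trLast_zero
        simpa using h.smul 0
      smul_mem' := fun r x h => by simpa using Chain.smul h r }
  have : IsClosed (V : Set (Op d (2 * n) × ℝ)) := V.closed_of_finiteDimensional
  exact this.preimage (by fun_prop : Continuous fun S : Op d (2 * n) => (S, s))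

end Chain

/-! ### Combs ending with an output -/

section Comb

variable {d : ℕ → ℕ}

theorem IsComb.posSemidef : ∀ {k : ℕ} {R : Op d k}, IsComb d k R → R.PosSemidef
  | 0, R, h => by
    have : R = 1 := h
    rw [this]; exact PosSemidef.one
  | 1, _, h => h.1
  | _ + 2, _, h => h.1

/-- The normalizations of combs and chains interlock: moving partial traces across the pairing
alternately strips one space from the comb and one from the chain, until only the scalar `s`
remains. -/
theorem IsComb.trace_mul_tensorOne_of_chain {n : ℕ} {R : Op d (2 * n + 1)}
    (hR : IsComb d (2 * n + 1) R) {S : Op d (2 * n)} {s : ℝ} (hS : Chain d n S s) :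
    trace (R * tensorOne d (2 * n) S) = s := by
  induction n with
  | zero =>
    have e : S = (s : ℂ) • (1 : Op d 0) := hS
    have h1 : trLast d 0 R = 1 := hR.2
    have h2 : trace (1 : Op d 0) = 1 := by
      change ∑ x : Unit, (1 : ℂ) = 1
      simp
    rw [trace_mul_tensorOne]
    change trace (trLast d 0 R * S) = _
    rw [h1, e, Matrix.one_mul, trace_smul, h2, smul_eq_mul, mul_one]
  | succ n ih =>
    obtain ⟨-, S', hS', hS2⟩ := hS
    obtain ⟨-, R', hR', hR2⟩ := hR
    rw [trace_mul_tensorOne]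
    change trace (trLast d (2 * n + 2) R * S) = _
    have hR3 : trLast d (2 * n + 2) R = tensorOne d (2 * n + 1) R' := hR2
    rw [hR3, ← ih hR' hS']
    have : trace (tensorOne d (2 * n + 1) R' * S) = trace (R' * trLast d (2 * n + 1) S) :=
      trace_tensorOne_mul _ _
    rw [this, hS2]

/-- Pairings with chains detect all the comb conditions. Chains with `s = 0` force the shape `𝟙 ⊗
R'` of the partial trace, and lifted shorter chains pass the hypothesis on to `R'`. -/
theorem isComb_of_trace (hd : ∀ i, 0 < d i) {n : ℕ} {R : Op d (2 * n + 1)} (hR : R.PosSemidef)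
    (h : ∀ S s, Chain d n S s → trace (R * tensorOne d (2 * n) S) = s) :
    IsComb d (2 * n + 1) R := by
  induction n with
  | zero =>
    refine ⟨hR, ?_⟩
    have h1 := h (1 : Op d 0) 1 (by change _ = _; simp)
    rw [trace_mul_tensorOne] at h1
    change trace (trLast d 0 R * (1 : Op d 0)) = _ at h1
    rw [Matrix.mul_one] at h1
    ext x y
    have h2 : trace (trLast d 0 R) = trLast d 0 R () () := by
      change ∑ x : Unit, trLast d 0 R () () = _
      simp
    rw [h2] at h1
    change trLast d 0 R () () = 1
    rw [h1]; simp
  | succ n ih =>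
    set Q : Op d (2 * n + 2) := trLast d (2 * n + 2) R with hQ
    have hQP : Q.PosSemidef := posSemidef_trLast hR
    have hd' : (d (2 * n + 2) : ℂ) ≠ 0 := by exact_mod_cast (hd _).ne'
    set e : ℝ := (d (2 * n + 2) : ℝ)⁻¹ with he
    have hed : (e : ℂ) * d (2 * n + 1 + 1) = 1 := by
      rw [he]; push_cast; field_simp
    set R' : Op d (2 * n + 1) := (e : ℂ) • trLast d (2 * n + 1) Q with hR'
    have hR'P : R'.PosSemidef := (posSemidef_trLast hQP).real_smul (by positivity)
    have hmul : ∀ S : Op d (2 * n + 2), trace (R * tensorOne d (2 * n + 2) S) = trace (Q * S) :=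
      fun S => trace_mul_tensorOne _ _
    obtain ⟨c, hc, hchain⟩ := exists_chain_one d n hd
    have hQeq : Q = tensorOne d (2 * n + 1) R' := by
      -- The defect `S` has zero partial trace, so it is itself a chain with scalar `0`. Testing
      -- against it gives `tr(S† S) = 0`.
      set S : Op d (2 * n + 2) := Q - tensorOne d (2 * n + 1) R' with hS
      have hSH : S.IsHermitian := hQP.isHermitian.sub (isHermitian_tensorOne hR'P.isHermitian)
      have htr : trLast d (2 * n + 1) S = 0 := by
        rw [hS, trLast_sub, trLast_tensorOne, hR', smul_smul, mul_comm _ (e : ℂ), hed,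
          one_smul, sub_self]
      have h0 : Chain d (n + 1) S 0 := by
        refine ⟨hSH, ((0 : ℝ) : ℂ) • ((c : ℂ) • 1), by simpa using hchain.smul 0, ?_⟩
        refine htr.trans ?_
        rw [tensorOne_smul]; simp
      have h1 : trace (Q * S) = 0 := by
        have := h S 0 h0
        rw [Complex.ofReal_zero] at this
        exact (hmul S).symm.trans this
      have h2 : trace (tensorOne d (2 * n + 1) R' * S) = 0 := by
        rw [trace_tensorOne_mul, htr]; simp
      have h3 : trace (Sᴴ * S) = 0 := by
        rw [hSH.eq]
        conv_lhs => enter [1, 1]; rw [hS]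
        rw [Matrix.sub_mul, trace_sub, h1, h2, sub_zero]
      have h4 := trace_conjTranspose_mul_self_eq_zero_iff.1 h3
      exact sub_eq_zero.1 h4
    refine ⟨hR, R', ih hR'P ?_, hQeq⟩
    intro S' s hS'
    set S : Op d (2 * n + 2) :=
      (e : ℂ) • tensorOne d (2 * n + 1) (tensorOne d (2 * n) S') with hS
    have hSC : Chain d (n + 1) S s := by
      refine ⟨(isHermitian_tensorOne (isHermitian_tensorOne hS'.isHermitian)).real_smul e, S', hS',
        ?_⟩
      rw [hS, trLast_smul, trLast_tensorOne, smul_smul, hed, one_smul]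
    rw [← h S s hSC]
    refine Eq.trans ?_ (hmul S).symm
    rw [hS, Matrix.mul_smul, trace_smul, trace_mul_tensorOne Q, hR', Matrix.smul_mul, trace_smul]

theorem isComb_iff_trace (hd : ∀ i, 0 < d i) {n : ℕ} {R : Op d (2 * n + 1)} :
    IsComb d (2 * n + 1) R ↔
      R.PosSemidef ∧ ∀ S s, Chain d n S s → trace (R * tensorOne d (2 * n) S) = s :=
  ⟨fun h => ⟨h.posSemidef, fun _ _ hS => h.trace_mul_tensorOne_of_chain hS⟩,
    fun h => isComb_of_trace hd h.1 h.2⟩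

/-- This positive definite comb is the reference point that supplies a priori bounds: pairing with
it controls full traces. -/
theorem exists_isComb_smul_one (hd : ∀ i, 0 < d i) (n : ℕ) :
    ∃ c : ℝ, 0 < c ∧ IsComb d (2 * n + 1) ((c : ℂ) • 1) := by
  induction n with
  | zero =>
    have hd' : (0 : ℝ) < d 1 := by exact_mod_cast hd 1
    refine ⟨(d 1 : ℝ)⁻¹, by positivity, PosSemidef.one.real_smul (by positivity), ?_⟩
    rw [trLast_smul]
    have h1 : (1 : Op d 1) = tensorOne d 0 1 := tensorOne_one.symm
    change _ • trLast d 0 (1 : Op d 1) = _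
    rw [h1, trLast_tensorOne, smul_smul]
    have : (d 1 : ℂ) ≠ 0 := by exact_mod_cast hd'.ne'
    push_cast
    rw [inv_mul_cancel₀ this, one_smul]
  | succ n ih =>
    obtain ⟨c, hc, h⟩ := ih
    have hd' : (0 : ℝ) < d (2 * n + 3) := by exact_mod_cast hd _
    refine ⟨c / d (2 * n + 3), by positivity, PosSemidef.one.real_smul (by positivity), _, h, ?_⟩
    have h1 : (1 : Op d (2 * n + 3)) = tensorOne d (2 * n + 2) 1 := tensorOne_one.symm
    change trLast d (2 * n + 2) (((c / d (2 * n + 3) : ℝ) : ℂ) • (1 : Op d (2 * n + 3))) =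
      tensorOne d (2 * n + 1) _
    rw [trLast_smul, h1, trLast_tensorOne, tensorOne_smul, tensorOne_one, smul_smul]
    congr 1
    have : (d (2 * n + 3) : ℂ) ≠ 0 := by exact_mod_cast hd'.ne'
    push_cast
    field_simp

theorem convex_isComb (hd : ∀ i, 0 < d i) (n : ℕ) :
    Convex ℝ {R : Op d (2 * n + 1) | IsComb d (2 * n + 1) R} := by
  intro R hR R' hR' a b ha hb hab
  rw [Set.mem_ofPred_eq, isComb_iff_trace hd] at hR hR' ⊢
  refine ⟨?_, fun S s hS => ?_⟩
  · simpa using (hR.1.real_smul ha).add (hR'.1.real_smul hb)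
  · rw [Matrix.add_mul, trace_add, Matrix.smul_mul, Matrix.smul_mul, trace_smul, trace_smul,
      hR.2 S s hS, hR'.2 S s hS, ← add_smul, hab, one_smul]

open scoped Matrix.Norms.Elementwise in
theorem isCompact_isComb (hd : ∀ i, 0 < d i) (n : ℕ) :
    IsCompact {R : Op d (2 * n + 1) | IsComb d (2 * n + 1) R} := by
  have : ProperSpace (Op d (2 * n + 1)) := FiniteDimensional.proper ℝ _
  obtain ⟨c, hc, hchain⟩ := exists_chain_one d n hd
  refine Metric.isCompact_of_isClosed_isBounded ?_ ?_
  · have : {R : Op d (2 * n + 1) | IsComb d (2 * n + 1) R} = {R | R.PosSemidef} ∩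
        ⋂ (S) (s) (_ : Chain d n S s), {R | trace (R * tensorOne d (2 * n) S) = (s : ℂ)} := by
      ext R
      simp only [Set.mem_ofPred_eq, Set.mem_inter_iff, Set.mem_iInter, isComb_iff_trace hd]
    rw [this]
    refine isClosed_posSemidef.inter (isClosed_iInter fun S => isClosed_iInter fun s =>
      isClosed_iInter fun _ => isClosed_eq ?_ continuous_const)
    fun_prop
  -- Pairing with the chain ending in `c • 1` fixes the trace of every comb at `c⁻¹`, and the trace
  -- bounds the entries of a positive matrix.
  · refine (Metric.isBounded_closedBall (x := (0 : Op d (2 * n + 1))) (r := c⁻¹)).subset ?_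
    intro R hR
    rw [mem_closedBall_zero_iff, Matrix.norm_le_iff (by positivity)]
    intro i j
    refine (IsComb.posSemidef hR).norm_apply_le_trace i j |>.trans (le_of_eq ?_)
    have h1 := IsComb.trace_mul_tensorOne_of_chain hR hchain
    rw [tensorOne_smul, tensorOne_one, Matrix.mul_smul, Matrix.mul_one, trace_smul,
      smul_eq_mul] at h1
    have h2 := congrArg Complex.re h1
    rw [Complex.re_ofReal_mul, Complex.ofReal_one, Complex.one_re] at h2
    field_simp
    linarith

end Comb

/-! ### Duality for the maximization of a linear functional over combs -/

section Duality

variable {d : ℕ → ℕ} {n : ℕ}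

theorem trace_smul_one_op_zero (c : ℂ) : trace (c • (1 : Op d 0)) = c := by
  rw [trace_smul]
  have : trace (1 : Op d 0) = 1 := by
    change ∑ x : Unit, (1 : ℂ) = 1
    simp
  rw [this, smul_eq_mul, mul_one]

theorem Chain.exists_family {S : Op d (2 * n)} {s : ℝ} (h : Chain d n S s) :
    ∃ F : ∀ k, Op d (2 * k), F n = S ∧ F 0 = (s : ℂ) • (1 : Op d 0) ∧
      (∀ k, k ≤ n → (F k).IsHermitian) ∧ DualTight d n F := by
  induction n with
  | zero =>
    refine ⟨Function.update (fun _ => 0) 0 S, Function.update_self .., ?_, ?_, ?_⟩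
    · rw [Function.update_self]; exact h
    · intro k hk
      obtain rfl : k = 0 := by omega
      rw [Function.update_self]
      exact h.isHermitian
    · intro k hk; omega
  | succ n ih =>
    obtain ⟨hS, S', hS', hS2⟩ := h
    obtain ⟨F, h1, h2, h3, h4⟩ := ih hS'
    have hne : ∀ k, k ≤ n → Function.update F (n + 1) S k = F k := fun k hk =>
      Function.update_of_ne (by omega) _ _
    refine ⟨Function.update F (n + 1) S, Function.update_self .., ?_, ?_, ?_⟩
    · rw [hne 0 (by omega), h2]
    · intro k hk
      rcases Nat.lt_or_ge n k with h | h
      · obtain rfl : k = n + 1 := by omega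
        rw [Function.update_self]; exact hS
      · rw [hne k h]; exact h3 k h
    · intro k hk
      rcases Nat.lt_or_ge k n with h | h
      · rw [hne k h.le, hne (k + 1) h]; exact h4 k h
      · obtain rfl : k = n := by omega
        rw [hne k le_rfl, Function.update_self, h1]
        exact hS2

theorem chain_of_family {F : ∀ k, Op d (2 * k)} {s : ℝ} (h0 : F 0 = (s : ℂ) • (1 : Op d 0))
    (hF : ∀ k, k ≤ n → (F k).IsHermitian) (ht : DualTight d n F) : Chain d n (F n) s := by
  induction n with
  | zero => exact h0
  | succ n ih =>
    exact ⟨hF _ le_rfl, F n, ih (fun k hk => hF k (by omega)) (fun k hk => ht k (by omega)),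
      ht n (by omega)⟩

/-- Weak duality: the same telescoping as for chains, where each inequality is used against the
positivity of the shorter comb. -/
theorem IsComb.trace_mul_tensorOne_le {R : Op d (2 * n + 1)} (hR : IsComb d (2 * n + 1) R)
    {S : ∀ k, Op d (2 * k)} (hle : ∀ k, k < n →
      (tensorOne d (2 * k) (S k) - trLast d (2 * k + 1) (S (k + 1))).PosSemidef) :
    (trace (R * tensorOne d (2 * n) (S n))).re ≤ (trace (S 0)).re := by
  induction n with
  | zero =>
    have h1 : trLast d 0 R = 1 := hR.2
    rw [trace_mul_tensorOne]
    change (trace (trLast d 0 R * S 0)).re ≤ _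
    rw [h1, Matrix.one_mul]
  | succ n ih =>
    obtain ⟨-, R', hR', hR2⟩ := hR
    have hR3 : trLast d (2 * n + 2) R = tensorOne d (2 * n + 1) R' := hR2
    rw [trace_mul_tensorOne]
    change (trace (trLast d (2 * n + 2) R * S (n + 1))).re ≤ _
    rw [hR3]
    have : trace (tensorOne d (2 * n + 1) R' * S (n + 1)) =
      trace (R' * trLast d (2 * n + 1) (S (n + 1))) := trace_tensorOne_mul _ _
    rw [this]
    exact (IsComb.posSemidef hR').trace_mul_re_le (hle n (by omega)) |>.trans
      (ih hR' fun k hk => hle k (by omega))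

variable (d n) in
/-- The Hermitian operators dominated by `𝟙 ⊗ S^{(n)}` for a chain with `S^{(0)} = p`. -/
def dominatedSet (p : ℝ) : Set (Op d (2 * n + 1)) :=
  {W | ∃ S, Chain d n S p ∧ (tensorOne d (2 * n) S - W).PosSemidef}

theorem convex_dominatedSet (p : ℝ) : Convex ℝ (dominatedSet d n p) := by
  rintro W ⟨S, hS, hW⟩ W' ⟨S', hS', hW'⟩ a b ha hb hab
  refine ⟨(a : ℂ) • S + (b : ℂ) • S', ?_, ?_⟩
  · have := (hS.smul a).add (hS'.smul b)
    rwa [← add_mul, hab, one_mul] at this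
  · have h := (hW.real_smul ha).add (hW'.real_smul hb)
    rw [tensorOne_add, tensorOne_smul, tensorOne_smul]
    convert h using 1
    simp only [smul_sub, Complex.coe_smul]
    abel

open scoped Matrix.Norms.Elementwise in
theorem norm_le_norm_tensorOne (hd : ∀ i, 0 < d i) {k : ℕ} (S : Op d k) :
    ‖S‖ ≤ ‖tensorOne d k S‖ := by
  rw [Matrix.norm_le_iff (norm_nonneg _)]
  intro x y
  let b : Fin (d (k + 1)) := ⟨0, hd _⟩
  have h := Matrix.norm_entry_le_entrywise_sup_norm (tensorOne d k S) (i := (x, b)) (j := (y, b))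
  rwa [tensorOne_apply, one_apply_eq, mul_one] at h

open scoped Matrix.Norms.Elementwise in
-- The witnesses `S` of a convergent sequence stay bounded: the comb `c • 1` fixes the trace of `𝟙 ⊗
-- S` at `p / c`, which bounds the positive difference `𝟙 ⊗ S - W` and hence `S`. A subsequence then
-- converges to a witness for the limit.
theorem isClosed_dominatedSet (hd : ∀ i, 0 < d i) (p : ℝ) : IsClosed (dominatedSet d n p) := by
  have : ProperSpace (Op d (2 * n)) := FiniteDimensional.proper ℝ _
  have : SequentialSpace (Op d (2 * n + 1)) :=
    inferInstanceAs (SequentialSpace (Idx d (2 * n + 1) → Idx d (2 * n + 1) → ℂ))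
  obtain ⟨c, hc, hR⟩ := exists_isComb_smul_one hd n
  refine IsSeqClosed.isClosed fun {W W₀} hW hlim => ?_
  choose S hS hP using hW
  obtain ⟨B, hB⟩ := (Metric.isBounded_range_of_tendsto _ hlim).exists_norm_le
  have htr : Tendsto (fun j => (trace (W j)).re) atTop (𝓝 (trace W₀).re) := by
    have hcont : Continuous fun M : Op d (2 * n + 1) => (trace M).re := by fun_prop
    exact (hcont.tendsto W₀).comp hlim
  obtain ⟨B', hB'⟩ := (Metric.isBounded_range_of_tendsto _ htr).exists_norm_le
  have hbound : ∀ j, ‖S j‖ ≤ (c⁻¹ * p + B') + B := by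
    intro j
    have h1 := hR.trace_mul_tensorOne_of_chain (hS j)
    rw [Matrix.smul_mul, Matrix.one_mul, trace_smul, smul_eq_mul] at h1
    have h2 : (trace (tensorOne d (2 * n) (S j))).re = c⁻¹ * p := by
      have := congrArg Complex.re h1
      rw [Complex.re_ofReal_mul, Complex.ofReal_re] at this
      field_simp
      linarith
    have h3 : |(trace (W j)).re| ≤ B' := hB' _ ⟨j, rfl⟩
    have hnn : 0 ≤ c⁻¹ * p + B' := by
      have := (Complex.le_def.1 (hP j).trace_nonneg).1
      rw [trace_sub, Complex.sub_re, h2] at this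
      have h5 := (abs_le.1 h3).1
      simp only [Complex.zero_re] at this
      linarith [(abs_le.1 h3).2]
    have h4 : ‖tensorOne d (2 * n) (S j) - W j‖ ≤ c⁻¹ * p + B' := by
      rw [Matrix.norm_le_iff hnn]
      intro x y
      refine ((hP j).norm_apply_le_trace x y).trans ?_
      rw [trace_sub, Complex.sub_re, h2]
      linarith [(abs_le.1 h3).1]
    calc ‖S j‖ ≤ ‖tensorOne d (2 * n) (S j)‖ := norm_le_norm_tensorOne hd _
      _ = ‖(tensorOne d (2 * n) (S j) - W j) + W j‖ := by rw [sub_add_cancel]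
      _ ≤ _ := (norm_add_le _ _).trans (add_le_add h4 (hB _ ⟨j, rfl⟩))
  obtain ⟨S₀, -, φ, hφ, hSφ⟩ := tendsto_subseq_of_bounded
    (Metric.isBounded_closedBall (x := (0 : Op d (2 * n))) (r := (c⁻¹ * p + B') + B))
    (x := S) (fun j => by rw [mem_closedBall_zero_iff]; exact hbound j)
  refine ⟨S₀, (isClosed_chain p).mem_of_tendsto hSφ (Eventually.of_forall fun j => hS _), ?_⟩
  have hlim2 : Tendsto (fun j => tensorOne d (2 * n) (S (φ j)) - W (φ j)) atTop
      (𝓝 (tensorOne d (2 * n) S₀ - W₀)) :=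
    ((continuous_tensorOne.tendsto S₀).comp hSφ).sub (hlim.comp hφ.tendsto_atTop)
  exact isClosed_posSemidef.mem_of_tendsto hlim2 (Eventually.of_forall fun j => hP _)

/-- If an affine function is bounded above on the nonnegative reals, its slope is nonpositive. -/
theorem nonpos_of_forall_add_mul_lt {a b u : ℝ} (h : ∀ t : ℝ, 0 ≤ t → a + t * b < u) : b ≤ 0 := by
  by_contra hb
  push Not at hb
  have h0 := h 0 le_rfl
  have := h ((u - a) / b) (div_nonneg (by linarith) hb.le)
  rw [div_mul_cancel₀ _ hb.ne'] at this
  linarith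

/-- Strong duality: a Hermitian operator whose expectation is at most `p` on every comb is dominated
by `𝟙 ⊗ S^{(n)}` for a chain with `S^{(0)} = p`. -/
theorem exists_chain_of_forall_le (hd : ∀ i, 0 < d i) {W : Op d (2 * n + 1)} (hW : W.IsHermitian)
    {p : ℝ} (hp : ∀ R, IsComb d (2 * n + 1) R → (trace (R * W)).re ≤ p) :
    ∃ S, Chain d n S p ∧ (tensorOne d (2 * n) S - W).PosSemidef := by
  change W ∈ dominatedSet d n p
  by_contra hcon
  have : LocallyConvexSpace ℝ (Op d (2 * n + 1)) :=
    inferInstanceAs (LocallyConvexSpace ℝ (Idx d (2 * n + 1) → Idx d (2 * n + 1) → ℂ))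
  obtain ⟨f, u, hf1, hf2⟩ := geometric_hahn_banach_closed_point (convex_dominatedSet (n := n) p)
    (isClosed_dominatedSet hd p) hcon
  have hfsmul : ∀ (r : ℝ) (X : Op d (2 * n + 1)), f ((r : ℂ) • X) = r * f X := fun r X => by
    rw [Complex.coe_smul, map_smul, smul_eq_mul]
  obtain ⟨R₀, hR₀⟩ := exists_trace_repr (f : Op d (2 * n + 1) →ₗ[ℝ] ℝ)
  -- Only Hermitian arguments matter, and on these the symmetrized `R` represents `2 f`.
  set R : Op d (2 * n + 1) := R₀ + R₀ᴴ with hRdef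
  have hRH : R.IsHermitian := isHermitian_add_transpose_self R₀
  have hfR : ∀ X : Op d (2 * n + 1), X.IsHermitian → (trace (R * X)).re = 2 * f X := by
    intro X hX
    have h1 : f X = (trace (R₀ * X)).re := hR₀ X
    have h2 : trace (R₀ᴴ * X) = star (trace (R₀ * X)) := by
      rw [← trace_conjTranspose, conjTranspose_mul, hX.eq, trace_mul_comm]
    rw [hRdef, Matrix.add_mul, trace_add, h2, Complex.add_re, h1]
    change _ + (starRingEnd ℂ _).re = _
    rw [Complex.conj_re]
    ring
  obtain ⟨c₁, hc₁, hS₁⟩ := exists_chain_one d n hd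
  set S₁ : Op d (2 * n) := (c₁ : ℂ) • 1 with hS₁def
  set T₁ := tensorOne d (2 * n) S₁ with hT₁
  have hmem : ∀ S, Chain d n S p → f (tensorOne d (2 * n) S) < u := fun S hS =>
    hf1 _ ⟨S, hS, by rw [sub_self]; exact PosSemidef.zero⟩
  have hpS₁ : Chain d n ((p : ℂ) • S₁) p := by simpa using hS₁.smul p
  have hRP : R.PosSemidef := by
    refine PosSemidef.of_dotProduct_mulVec_nonneg hRH fun x => ?_
    set P := vecMulVec x (star x) with hPdef
    have hP : P.PosSemidef := posSemidef_vecMulVec_self_star x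
    -- The dominated set is stable under subtracting positive operators, so a functional bounded
    -- above on it is nonnegative on them.
    have hfP : 0 ≤ f P := by
      have : - f P ≤ 0 := by
        refine nonpos_of_forall_add_mul_lt (a := f (tensorOne d (2 * n) ((p : ℂ) • S₁))) (u := u)
          fun t ht => ?_
        have h := hf1 (tensorOne d (2 * n) ((p : ℂ) • S₁) - t • P) ⟨_, hpS₁, by
          rw [sub_sub_cancel]
          simpa using hP.real_smul ht⟩
        rw [map_sub, map_smul, smul_eq_mul] at h
        linarith
      linarith
    have h1 : trace (R * P) = star x ⬝ᵥ (R *ᵥ x) := by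
      rw [hPdef, mul_vecMulVec, trace_vecMulVec, dotProduct_comm]
    have h2 := hRH.trace_mul_eq_re hP.isHermitian
    rw [← h1, h2, hfR P hP.isHermitian]
    exact_mod_cast (by linarith : 0 ≤ 2 * f P)
  set c := 2 * f T₁ with hcdef
  have hT₁H : T₁.IsHermitian := isHermitian_tensorOne hS₁.isHermitian
  have hfS : ∀ S s, Chain d n S s → trace (R * tensorOne d (2 * n) S) = ((c * s : ℝ) : ℂ) := by
    intro S s hS
    -- Chains with scalar `0` span full lines inside the set, so `f` vanishes on them and `tr[R (𝟙 ⊗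
    -- S)]` depends on `S` only through `s`.
    have hZ : Chain d n (S + ((-s : ℝ) : ℂ) • S₁) 0 := by
      simpa using hS.add (hS₁.smul (-s))
    have hslope : ∀ r : ℝ, r * f (tensorOne d (2 * n) (S + ((-s : ℝ) : ℂ) • S₁)) ≤ 0 := by
      intro r
      refine nonpos_of_forall_add_mul_lt (a := f (tensorOne d (2 * n) ((p : ℂ) • S₁))) (u := u)
        fun t ht => ?_
      have h := hmem ((p : ℂ) • S₁ + ((t * r : ℝ) : ℂ) • (S + ((-s : ℝ) : ℂ) • S₁))
        (by simpa using hpS₁.add (hZ.smul (t * r)))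
      rw [tensorOne_add, tensorOne_smul ((t * r : ℝ) : ℂ), map_add, hfsmul] at h
      linarith
    have h0 : f (tensorOne d (2 * n) (S + ((-s : ℝ) : ℂ) • S₁)) = 0 := by
      have h1 := hslope 1
      have h2 := hslope (-1)
      linarith
    rw [tensorOne_add, tensorOne_smul, map_add, hfsmul] at h0
    have hSH := isHermitian_tensorOne hS.isHermitian
    rw [hRH.trace_mul_eq_re hSH, hfR _ hSH]
    congr 1
    rw [hcdef]
    linarith
  have hc0 : 0 ≤ c := by
    rw [hcdef, ← hfR T₁ hT₁H]
    have hT₁P : T₁.PosSemidef := by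
      rw [hT₁, hS₁def, tensorOne_smul, tensorOne_one]
      exact PosSemidef.one.real_smul hc₁.le
    exact hRP.trace_mul_re_nonneg hT₁P
  have hup : p * c < 2 * u := by
    have := hmem _ hpS₁
    rw [tensorOne_smul, hfsmul] at this
    rw [hcdef]
    linarith
  have hWu : 2 * u < (trace (R * W)).re := by rw [hfR W hW]; linarith
  -- If `c = 0`, then `R` is positive with zero trace, hence zero, and cannot separate strictly.
  -- Otherwise `c⁻¹ • R` is a comb whose value on `W` exceeds `p`.
  rcases hc0.eq_or_lt with h0 | hpos
  · have h1 := hfS _ _ hS₁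
    rw [hS₁def, ← h0, zero_mul, Complex.ofReal_zero, tensorOne_smul, tensorOne_one, Matrix.mul_smul,
      Matrix.mul_one, trace_smul, smul_eq_mul, mul_eq_zero] at h1
    have h2 : trace R = 0 := h1.resolve_left (by exact_mod_cast hc₁.ne')
    have h3 := hRP.trace_eq_zero_iff.1 h2
    rw [h3] at hWu
    rw [← h0] at hup
    simp at hWu hup
    linarith
  · have hcomb : IsComb d (2 * n + 1) (((c⁻¹ : ℝ) : ℂ) • R) := by
      refine isComb_of_trace hd (hRP.real_smul (by positivity)) fun S s hS => ?_
      rw [Matrix.smul_mul, trace_smul, hfS S s hS, smul_eq_mul, ← Complex.ofReal_mul]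
      congr 1
      field_simp
    have h1 := hp _ hcomb
    rw [Matrix.smul_mul, trace_smul, smul_eq_mul, Complex.re_ofReal_mul] at h1
    have h2 : (trace (R * W)).re ≤ p * c := by
      rw [inv_mul_le_iff₀ hpos] at h1
      linarith
    linarith

end Duality

/-! ### Quantum Fisher information of output states -/

section Output

variable {γ β α κ : Type} [Fintype γ] [Fintype β] [Fintype α] [Fintype κ] {q : ℕ}

/-- The vectors `|w_i⟩ * |B_k⟩` obtained by linking vectors `|w_i⟩` with the columns of `B`, as the
columns of a matrix. -/
def linkCols (w : Fin q → γ × β → ℂ) (B : Matrix (γ × α) κ ℂ) :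
    Matrix (β × α) (Fin q × κ) ℂ :=
  of fun x y => ∑ g, w y.1 (g, x.1) * B (g, x.2) y.2

/-- `4 ∑_i tr_β (|w_i⟩⟨w_i|)^{T_γ}`. -/
def redGram (w : Fin q → γ × β → ℂ) : Matrix γ γ ℂ :=
  partialTrace ((4 : ℂ) • ∑ i, partialTranspose (vecMulVec (w i) (star (w i))))

omit [Fintype γ] in
theorem redGram_apply (w : Fin q → γ × β → ℂ) (g g' : γ) :
    redGram w g g' = 4 * ∑ b, ∑ i, w i (g', b) * star (w i (g, b)) := by
  simp only [redGram, partialTrace, Matrix.smul_apply, Matrix.sum_apply, partialTranspose,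
    vecMulVec_apply, Pi.star_apply, smul_eq_mul, Finset.mul_sum]

omit [Fintype β] [Fintype α] in
-- An ensemble decomposition of the comb together with a factor of the probe gives an explicit
-- factor of the output state, to which the results on `Φ Φ†` apply.
theorem linkProduct_eq_linkCols (w : Fin q → γ × β → ℂ) (B : Matrix (γ × α) κ ℂ) :
    linkProduct (∑ i, vecMulVec (w i) (star (w i))) (B * Bᴴ) =
      linkCols w B * (linkCols w B)ᴴ := by
  ext ⟨b, x⟩ ⟨b', x'⟩
  simp only [linkProduct, partialTranspose, Matrix.sum_apply, vecMulVec_apply, Pi.star_apply,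
    mul_apply, conjTranspose_apply, linkCols, of_apply, star_sum, star_mul', Finset.sum_mul_sum,
    Fintype.sum_prod_type]
  rw [Finset.sum_comm]
  conv_rhs => enter [2, i]; rw [Finset.sum_comm]
  conv_rhs => rw [Finset.sum_comm]
  refine Finset.sum_congr rfl fun g _ => ?_
  conv_rhs => enter [2, i]; rw [Finset.sum_comm]
  conv_rhs => rw [Finset.sum_comm]
  refine Finset.sum_congr rfl fun g' _ => Finset.sum_congr rfl fun i _ =>
    Finset.sum_congr rfl fun k _ => ?_
  ring

theorem four_mul_trace_linkCols (w : Fin q → γ × β → ℂ) (B : Matrix (γ × α) κ ℂ) :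
    4 * trace (linkCols w B * (linkCols w B)ᴴ) =
      trace (partialTrace (B * Bᴴ) * redGram w) := by
  simp only [trace, diag_apply, mul_apply, conjTranspose_apply, linkCols, of_apply, star_sum,
    star_mul', Fintype.sum_prod_type, redGram_apply, partialTrace,
    Finset.mul_sum, Finset.sum_mul]
  have e1 : ∀ F : β → α → Fin q → κ → γ → γ → ℂ,
      ∑ b, ∑ x, ∑ i, ∑ k, ∑ g, ∑ g', F b x i k g g' =
        ∑ g', ∑ g, ∑ b, ∑ i, ∑ x, ∑ k, F b x i k g g' := by
    intro F
    simp only [← Fintype.sum_prod_type']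
    exact Fintype.sum_equiv
      ⟨fun p => (p.2.2.2.2.2, p.2.2.2.2.1, p.1, p.2.2.1, p.2.1, p.2.2.2.1),
        fun p => (p.2.2.1, p.2.2.2.2.1, p.2.2.2.1, p.2.2.2.2.2, p.2.1, p.1),
        fun _ => rfl, fun _ => rfl⟩ _ _ fun _ => rfl
  rw [e1]
  refine Finset.sum_congr rfl fun g _ => Finset.sum_congr rfl fun g' _ =>
    Finset.sum_congr rfl fun b _ => Finset.sum_congr rfl fun i _ =>
    Finset.sum_congr rfl fun x _ => Finset.sum_congr rfl fun k _ => ?_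
  ring

omit [Fintype β] [Fintype α] in
-- The freedom in `h` acts on the factor `Φ` by right multiplication, that is, as a gauge direction
-- of `Φ Φ†`.
theorem linkCols_dotVec [DecidableEq κ] (v : Fin q → ℝ → γ × β → ℂ) (θ : ℝ)
    (h : Matrix (Fin q) (Fin q) ℂ) (B : Matrix (γ × α) κ ℂ) :
    linkCols (dotVec v θ h) B = linkCols (fun i m => deriv (fun t => v i t m) θ) B -
      Complex.I • (linkCols (fun i => v i θ) B * (hᵀ ⊗ₖ (1 : Matrix κ κ ℂ))) := by
  ext ⟨b, x⟩ ⟨i, k⟩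
  simp only [linkCols, dotVec, of_apply, Matrix.sub_apply, Matrix.smul_apply, mul_apply,
    Fintype.sum_prod_type, kroneckerMap_apply, transpose_apply, one_apply, mul_ite, mul_one,
    mul_zero, Finset.sum_ite_eq', Finset.mem_univ, if_true, smul_eq_mul, sub_mul,
    Finset.sum_sub_distrib, Finset.mul_sum, Finset.sum_mul]
  congr 1
  rw [Finset.sum_comm]
  refine Finset.sum_congr rfl fun j _ => Finset.sum_congr rfl fun g _ => ?_
  ring

omit [Fintype β] [Fintype α] in
theorem gauge_invariance [DecidableEq κ] {Φ D : Matrix (β × α) κ ℂ} {H : Matrix κ κ ℂ}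
    (hH : H.IsHermitian) :
    (D - Complex.I • (Φ * H)) * Φᴴ + Φ * (D - Complex.I • (Φ * H))ᴴ = D * Φᴴ + Φ * Dᴴ := by
  simp only [conjTranspose_sub, conjTranspose_smul, conjTranspose_mul, hH.eq, Matrix.sub_mul,
    Matrix.mul_sub, Matrix.smul_mul, Matrix.mul_smul, Matrix.mul_assoc, Complex.star_def,
    Complex.conj_I, neg_smul, Matrix.mul_neg]
  abel

theorem exists_eq_mul_conjTranspose {ι : Type} [Fintype ι] {A : Matrix ι ι ℂ}
    (hA : A.PosSemidef) : ∃ X : Matrix ι ι ℂ, A = X * Xᴴ := by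
  classical
  obtain ⟨X, hX⟩ : ∃ X : Matrix ι ι ℂ, A = Xᴴ * X := by
    open scoped MatrixOrder in
    simpa [star_eq_conjTranspose] using CStarAlgebra.nonneg_iff_eq_star_mul_self.1 hA.nonneg
  exact ⟨Xᴴ, by rw [conjTranspose_conjTranspose]; exact hX⟩

variable {v : Fin q → ℝ → γ × β → ℂ} {C : ℝ → Matrix (γ × β) (γ × β) ℂ} {θ : ℝ}

omit [Fintype β] [Fintype α] [Fintype κ] in
theorem hasDerivAt_linkCols (hv : ∀ i m, DifferentiableAt ℝ (fun t => v i t m) θ)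
    (B : Matrix (γ × α) κ ℂ) (x : β × α) (y : Fin q × κ) :
    HasDerivAt (fun t => linkCols (fun i => v i t) B x y)
      (linkCols (fun i m => deriv (fun t => v i t m) θ) B x y) θ := by
  simp only [linkCols, of_apply]
  exact HasDerivAt.fun_sum fun g _ => (hv _ _).hasDerivAt.mul_const _

omit [Fintype β] [Fintype α] in
theorem hasDerivAt_linkProduct (hv : ∀ i m, DifferentiableAt ℝ (fun t => v i t m) θ)
    (hC : ∀ᶠ t in 𝓝 θ, C t = ∑ i, vecMulVec (v i t) (star (v i t)))
    (B : Matrix (γ × α) κ ℂ) (x y : β × α) :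
    HasDerivAt (fun t => linkProduct (C t) (B * Bᴴ) x y)
      ((linkCols (fun i m => deriv (fun t => v i t m) θ) B * (linkCols (fun i => v i θ) B)ᴴ +
        linkCols (fun i => v i θ) B * (linkCols (fun i m => deriv (fun t => v i t m) θ) B)ᴴ) x y)
      θ := by
  have h1 : HasDerivAt
      (fun t => (linkCols (fun i => v i t) B * (linkCols (fun i => v i t) B)ᴴ) x y)
      ((linkCols (fun i m => deriv (fun t => v i t m) θ) B * (linkCols (fun i => v i θ) B)ᴴ +
        linkCols (fun i => v i θ) B * (linkCols (fun i m => deriv (fun t => v i t m) θ) B)ᴴ) x y)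
      θ := by
    simp only [Matrix.add_apply, mul_apply, conjTranspose_apply, ← Finset.sum_add_distrib]
    exact HasDerivAt.fun_sum fun k _ =>
      (hasDerivAt_linkCols hv B x k).mul (hasDerivAt_linkCols hv B y k).star
  refine h1.congr_of_eventuallyEq ?_
  filter_upwards [hC] with t ht
  rw [ht, linkProduct_eq_linkCols]

theorem isSLD_linkProduct (hv : ∀ i m, DifferentiableAt ℝ (fun t => v i t m) θ)
    (hC : ∀ᶠ t in 𝓝 θ, C t = ∑ i, vecMulVec (v i t) (star (v i t)))
    {B : Matrix (γ × α) κ ℂ} {Φ D : Matrix (β × α) (Fin q × κ) ℂ} {L : Matrix (β × α) (β × α) ℂ}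
    (hΦ : Φ = linkCols (fun i => v i θ) B)
    (hD : D = linkCols (fun i m => deriv (fun t => v i t m) θ) B) (hL : L.IsHermitian)
    (hL2 : D * Φᴴ + Φ * Dᴴ = (1 / 2 : ℂ) • (L * (Φ * Φᴴ) + (Φ * Φᴴ) * L)) :
    IsSLD (fun t => linkProduct (C t) (B * Bᴴ)) θ L := by
  refine ⟨hL, fun x y => ?_⟩
  have h := hasDerivAt_linkProduct hv hC B x y
  rw [← hΦ, ← hD, hL2] at h
  simp only [hC.self_of_nhds, linkProduct_eq_linkCols, ← hΦ]
  exact h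

theorem exists_isSLD_linkProduct (hv : ∀ i m, DifferentiableAt ℝ (fun t => v i t m) θ)
    (hC : ∀ᶠ t in 𝓝 θ, C t = ∑ i, vecMulVec (v i t) (star (v i t)))
    (B : Matrix (γ × α) κ ℂ) :
    ∃ L, IsSLD (fun t => linkProduct (C t) (B * Bᴴ)) θ L := by
  obtain ⟨L, hL, hL2⟩ := exists_sld_of_factor (linkCols (fun i => v i θ) B)
    (linkCols (fun i m => deriv (fun t => v i t m) θ) B)
  exact ⟨L, isSLD_linkProduct hv hC rfl rfl hL hL2⟩

/-- The shifted tangent has the same symmetrized product with `Φ` by `gauge_invariance`, so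
`trace_sld_sq_le` applies to it. No rank assumption enters this bound. -/
theorem stateQFI_linkProduct_le (hv : ∀ i m, DifferentiableAt ℝ (fun t => v i t m) θ)
    (hC : ∀ᶠ t in 𝓝 θ, C t = ∑ i, vecMulVec (v i t) (star (v i t)))
    (B : Matrix (γ × α) κ ℂ) {h : Matrix (Fin q) (Fin q) ℂ} (hh : h.IsHermitian) :
    stateQFI (fun t => linkProduct (C t) (B * Bᴴ)) θ ≤
      (trace (partialTrace (B * Bᴴ) * redGram (dotVec v θ h))).re := by
  classical
  obtain ⟨L, hL, hL2⟩ := exists_sld_of_factor (linkCols (fun i => v i θ) B)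
    (linkCols (fun i m => deriv (fun t => v i t m) θ) B)
  have e : linkProduct (C θ) (B * Bᴴ) =
      linkCols (fun i => v i θ) B * (linkCols (fun i => v i θ) B)ᴴ := by
    rw [hC.self_of_nhds, linkProduct_eq_linkCols]
  have hsld := isSLD_linkProduct hv hC rfl rfl hL hL2
  rw [stateQFI_eq hsld, e, ← four_mul_trace_linkCols]
  have hH : (hᵀ ⊗ₖ (1 : Matrix κ κ ℂ)).IsHermitian := by
    rw [IsHermitian, conjTranspose_kronecker, hh.transpose.eq, conjTranspose_one]
  have key := trace_sld_sq_le (Y := linkCols (dotVec v θ h) B) hL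
    (by rw [linkCols_dotVec, gauge_invariance hH, hL2])
  have : (4 : ℂ) = ((4 : ℝ) : ℂ) := by norm_num
  rw [this, Complex.re_ofReal_mul]
  exact key

/-- For a pure probe the column index of `B` is trivial, so every Hermitian gauge matrix on `Fin q ×
Unit` arises from some `h`, including the one that makes the tangent equal to `L Φ / 2`. -/
theorem exists_stateQFI_linkProduct_eq (hv : ∀ i m, DifferentiableAt ℝ (fun t => v i t m) θ)
    (hC : ∀ᶠ t in 𝓝 θ, C t = ∑ i, vecMulVec (v i t) (star (v i t)))
    (ψ : γ × α → ℂ)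
    (hrank : ∀ᶠ t in 𝓝 θ, (linkProduct (C t) (vecMulVec ψ (star ψ))).rank =
      (linkProduct (C θ) (vecMulVec ψ (star ψ))).rank) :
    ∃ h : Matrix (Fin q) (Fin q) ℂ, h.IsHermitian ∧
      stateQFI (fun t => linkProduct (C t) (vecMulVec ψ (star ψ))) θ =
        (trace (partialTrace (vecMulVec ψ (star ψ)) * redGram (dotVec v θ h))).re := by
  classical
  set B : Matrix (γ × α) Unit ℂ := replicateCol Unit ψ with hB
  have hψ : vecMulVec ψ (star ψ) = B * Bᴴ := by
    rw [hB, conjTranspose_replicateCol, ← vecMulVec_eq]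
  rw [hψ] at hrank ⊢
  set Φ := linkCols (fun i => v i θ) B with hΦ
  set D := linkCols (fun i m => deriv (fun t => v i t m) θ) B with hD
  obtain ⟨L, hL, hL2⟩ := exists_sld_of_factor Φ D
  have e : linkProduct (C θ) (B * Bᴴ) = Φ * Φᴴ := by
    rw [hC.self_of_nhds, linkProduct_eq_linkCols]
  have hsld := isSLD_linkProduct hv hC rfl rfl hL hL2
  have hr : ∀ᶠ t in 𝓝 θ, (linkCols (fun i => v i t) B).rank ≤ Φ.rank := by
    filter_upwards [hC, hrank] with t h1 h2
    rw [e, h1, linkProduct_eq_linkCols, rank_self_mul_conjTranspose,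
      rank_self_mul_conjTranspose] at h2
    exact h2.le
  obtain ⟨H, hH, hH2⟩ := exists_hermitian_gauge hL hL2
    (deriv_mulVec_mem_range_of_rank_le (hasDerivAt_linkCols hv B) hr)
  set h : Matrix (Fin q) (Fin q) ℂ := of fun i j => H (j, ()) (i, ()) with hh
  have hhH : hᵀ ⊗ₖ (1 : Matrix Unit Unit ℂ) = H := by
    ext ⟨i, _⟩ ⟨j, _⟩
    simp [hh]
  refine ⟨h, ?_, ?_⟩
  · ext i j
    exact hH.apply _ _
  · rw [stateQFI_eq hsld, e, ← four_mul_trace_linkCols]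
    have : (4 : ℂ) = ((4 : ℝ) : ℂ) := by norm_num
    rw [this, Complex.re_ofReal_mul]
    exact trace_sld_sq_eq hL (by rw [linkCols_dotVec, hhH, hH2])

end Output

/-! ### A saddle point theorem -/

/-- A saddle point exists for functions which are convex and coercive in the first variable on a
subspace and affine in the second variable on a compact convex set. -/
theorem exists_saddlePoint {E F : Type*} [NormedAddCommGroup E] [NormedSpace ℝ E]
    [FiniteDimensional ℝ E] [TopologicalSpace F] [AddCommGroup F] [Module ℝ F]
    [IsTopologicalAddGroup F] [ContinuousSMul ℝ F] (V : Submodule ℝ E) {K : Set F}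
    (hKc : IsCompact K) (hKconv : Convex ℝ K) {f : E → F → ℝ}
    (hconv : ∀ R ∈ K, ConvexOn ℝ Set.univ fun y => f y R)
    (hcont : ∀ R ∈ K, Continuous fun y => f y R)
    (hconc : ∀ y, ConcaveOn ℝ K (f y)) (hcont' : ∀ y, Continuous (f y))
    {R₀ : F} (hR₀ : R₀ ∈ K) (hcoer : ∀ M, ∃ r, ∀ y ∈ V, f y R₀ ≤ M → ‖y‖ ≤ r) :
    ∃ a ∈ V, ∃ b ∈ K, ∀ y ∈ V, ∀ R ∈ K, f a R ≤ f y b := by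
  obtain ⟨R₁, hR₁, hmax⟩ := hKc.exists_isMaxOn ⟨R₀, hR₀⟩ (hcont' 0).continuousOn
  obtain ⟨r, hr⟩ := hcoer (f 0 R₁)
  have : ProperSpace E := FiniteDimensional.proper ℝ E
  -- The extra `1` in the radius keeps the saddle point, whose norm is at most `|r|` by coercivity,
  -- away from the boundary of the ball.
  set X : Set E := (V : Set E) ∩ Metric.closedBall 0 (|r| + 1) with hX
  have hXc : IsCompact X :=
    (isCompact_closedBall _ _).inter_left V.closed_of_finiteDimensional
  have hXconv : Convex ℝ X := V.convex.inter (convex_closedBall _ _)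
  have h0X : (0 : E) ∈ X := ⟨V.zero_mem, by
    rw [mem_closedBall_zero_iff, norm_zero]; positivity⟩
  obtain ⟨a, ha, b, hb, hab⟩ := Sion.exists_isSaddlePointOn (f := f) ⟨0, h0X⟩ hXconv hXc
    (fun R hR => (hcont R hR).lowerSemicontinuous.lowerSemicontinuousOn _)
    (fun R hR => ((hconv R hR).subset (Set.subset_univ _) hXconv).quasiconvexOn)
    hKconv ⟨R₀, hR₀⟩ hKc
    (fun y _ => (hcont' y).upperSemicontinuous.upperSemicontinuousOn _)
    (fun y _ => (hconc y).quasiconcaveOn)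
  have har : ‖a‖ ≤ |r| :=
    (hr a ha.1 ((hab 0 h0X R₀ hR₀).trans (hmax hb))).trans (le_abs_self r)
  refine ⟨a, ha.1, b, hb, fun y hy R hR => (hab a ha R hR).trans ?_⟩
  -- A step from `a` towards `y` of length at most `1` stays in the ball. By convexity, minimality
  -- there implies minimality on all of `V`.
  set t : ℝ := (1 + ‖y - a‖)⁻¹ with ht
  have hn : 0 ≤ ‖y - a‖ := norm_nonneg _
  have ht0 : 0 < t := by positivity
  have ht1 : t ≤ 1 := inv_le_one_of_one_le₀ (by linarith)
  have hta : t * ‖y - a‖ ≤ 1 := by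
    rw [ht, inv_mul_le_iff₀ (by positivity)]; linarith
  have hmem : (1 - t) • a + t • y ∈ X := by
    refine ⟨V.add_mem (V.smul_mem _ ha.1) (V.smul_mem _ hy), ?_⟩
    rw [mem_closedBall_zero_iff]
    have : (1 - t) • a + t • y = a + t • (y - a) := by module
    rw [this]
    refine (norm_add_le _ _).trans ?_
    rw [norm_smul, Real.norm_of_nonneg ht0.le]
    linarith
  have h1 := hab _ hmem b hb
  have h2 := (hconv b hb).2 (Set.mem_univ a) (Set.mem_univ y) (by linarith : 0 ≤ 1 - t) ht0.le
    (by ring)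
  simp only [smul_eq_mul] at h2
  have h3 : t * f a b ≤ t * f y b := by linarith
  exact le_of_mul_le_mul_left h3 ht0

/-! ### The reduced performance operator as a function of the amplitudes -/

section RedGram

variable {γ β : Type} [Fintype γ] [Fintype β] {q : ℕ}

omit [Fintype γ] in
theorem redGram_eq_mul_conjTranspose (w : Fin q → γ × β → ℂ) :
    redGram w = (4 : ℂ) • ((of fun (g : γ) (im : Fin q × β) => star (w im.1 (g, im.2))) *
      (of fun (g : γ) (im : Fin q × β) => star (w im.1 (g, im.2)))ᴴ) := by
  ext g g'
  rw [redGram_apply, Matrix.smul_apply, mul_apply, smul_eq_mul, Fintype.sum_prod_type,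
    Finset.sum_comm]
  congr 1
  refine Finset.sum_congr rfl fun i _ => Finset.sum_congr rfl fun b _ => ?_
  simp [mul_comm]

theorem posSemidef_redGram (w : Fin q → γ × β → ℂ) : (redGram w).PosSemidef := by
  rw [redGram_eq_mul_conjTranspose]
  exact (posSemidef_self_mul_conjTranspose _).smul (by norm_num)

omit [Fintype γ] in
theorem continuous_redGram : Continuous (redGram : (Fin q → γ × β → ℂ) → Matrix γ γ ℂ) := by
  refine continuous_pi fun g => continuous_pi fun g' => ?_
  simp only [redGram_apply]
  fun_prop

theorem trace_redGram_re (w : Fin q → γ × β → ℂ) :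
    (trace (redGram w)).re = 4 * ∑ g, ∑ b, ∑ i, ‖w i (g, b)‖ ^ 2 := by
  rw [trace, Complex.re_sum, Finset.mul_sum]
  refine Finset.sum_congr rfl fun g _ => ?_
  have : redGram w g g = ((4 * ∑ b, ∑ i, ‖w i (g, b)‖ ^ 2 : ℝ) : ℂ) := by
    rw [redGram_apply]
    push_cast
    congr 1
    refine Finset.sum_congr rfl fun b _ => Finset.sum_congr rfl fun i _ => ?_
    rw [Complex.star_def, Complex.mul_conj, Complex.normSq_eq_norm_sq]
    push_cast
    rfl
  rw [diag_apply, this, Complex.ofReal_re]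

/-- With `R = X X†` the function is a sum of squared moduli of linear forms in `w`. -/
theorem convexOn_trace_mul_redGram {R : Matrix γ γ ℂ} (hR : R.PosSemidef) :
    ConvexOn ℝ Set.univ fun w : Fin q → γ × β → ℂ => (trace (R * redGram w)).re := by
  obtain ⟨X, rfl⟩ := exists_eq_mul_conjTranspose hR
  set B : Matrix (γ × Unit) γ ℂ := of fun x k => X x.1 k with hB
  have hpt : partialTrace (B * Bᴴ) = X * Xᴴ := by
    ext g g'
    simp [partialTrace, mul_apply, hB]
  have hval : ∀ w : Fin q → γ × β → ℂ, (trace (X * Xᴴ * redGram w)).re =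
      4 * ∑ x, ∑ y, ‖linkCols w B x y‖ ^ 2 := by
    intro w
    have h4 : (4 : ℂ) = ((4 : ℝ) : ℂ) := by norm_num
    rw [← hpt, ← four_mul_trace_linkCols, h4, Complex.re_ofReal_mul, trace, Complex.re_sum]
    congr 1
    refine Finset.sum_congr rfl fun x _ => ?_
    rw [diag_apply, mul_apply, Complex.re_sum]
    refine Finset.sum_congr rfl fun y _ => ?_
    rw [conjTranspose_apply, Complex.star_def, Complex.mul_conj, Complex.ofReal_re,
      Complex.normSq_eq_norm_sq]
  simp only [hval]
  refine ⟨convex_univ, fun w _ w' _ a b ha hb hab => ?_⟩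
  have hlin : ∀ x y, linkCols (a • w + b • w') B x y =
      (a : ℂ) * linkCols w B x y + (b : ℂ) * linkCols w' B x y := by
    intro x y
    simp only [linkCols, of_apply, Pi.add_apply, Pi.smul_apply, Complex.real_smul, add_mul,
      Finset.sum_add_distrib, Finset.mul_sum, mul_assoc]
  have hpt : ∀ z z' : ℂ, ‖(a : ℂ) * z + (b : ℂ) * z'‖ ^ 2 ≤ a * ‖z‖ ^ 2 + b * ‖z'‖ ^ 2 := by
    intro z z'
    have h1 : ‖(a : ℂ) * z + (b : ℂ) * z'‖ ≤ a * ‖z‖ + b * ‖z'‖ := by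
      refine (norm_add_le _ _).trans (le_of_eq ?_)
      rw [norm_mul, norm_mul, Complex.norm_of_nonneg ha, Complex.norm_of_nonneg hb]
    have h2 : ‖(a : ℂ) * z + (b : ℂ) * z'‖ ^ 2 ≤ (a * ‖z‖ + b * ‖z'‖) ^ 2 :=
      pow_le_pow_left₀ (norm_nonneg _) h1 2
    obtain rfl : b = 1 - a := by linarith
    nlinarith [mul_nonneg (mul_nonneg ha hb) (sq_nonneg (‖z‖ - ‖z'‖))]
  simp only [hlin, smul_eq_mul]
  have hsum : a * (4 * ∑ x, ∑ y, ‖linkCols w B x y‖ ^ 2) +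
      b * (4 * ∑ x, ∑ y, ‖linkCols w' B x y‖ ^ 2) =
      4 * ∑ x, ∑ y, (a * ‖linkCols w B x y‖ ^ 2 + b * ‖linkCols w' B x y‖ ^ 2) := by
    simp only [Finset.sum_add_distrib, ← Finset.mul_sum]
    ring
  rw [hsum]
  exact mul_le_mul_of_nonneg_left
    (Finset.sum_le_sum fun x _ => Finset.sum_le_sum fun y _ => hpt _ _) (by norm_num)

theorem norm_le_of_trace_redGram_le {w : Fin q → γ × β → ℂ} {c M : ℝ} (hc : 0 < c)
    (h : c * (trace (redGram w)).re ≤ M) : ‖w‖ ≤ Real.sqrt (M / (4 * c)) := by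
  rw [trace_redGram_re] at h
  refine (pi_norm_le_iff_of_nonneg (Real.sqrt_nonneg _)).2 fun i =>
    (pi_norm_le_iff_of_nonneg (Real.sqrt_nonneg _)).2 fun m => Real.le_sqrt_of_sq_le ?_
  obtain ⟨g, b⟩ := m
  rw [le_div_iff₀ (by positivity)]
  refine le_trans ?_ h
  have s1 : ‖w i (g, b)‖ ^ 2 ≤ ∑ i, ‖w i (g, b)‖ ^ 2 :=
    Finset.single_le_sum (f := fun i => ‖w i (g, b)‖ ^ 2) (fun _ _ => by positivity)
      (Finset.mem_univ i)
  have s2 : ∑ i, ‖w i (g, b)‖ ^ 2 ≤ ∑ b, ∑ i, ‖w i (g, b)‖ ^ 2 :=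
    Finset.single_le_sum (f := fun b => ∑ i, ‖w i (g, b)‖ ^ 2) (fun _ _ => by positivity)
      (Finset.mem_univ b)
  have s3 : ∑ b, ∑ i, ‖w i (g, b)‖ ^ 2 ≤ ∑ g, ∑ b, ∑ i, ‖w i (g, b)‖ ^ 2 :=
    Finset.single_le_sum (f := fun g => ∑ b, ∑ i, ‖w i (g, b)‖ ^ 2)
      (fun _ _ => by positivity) (Finset.mem_univ g)
  calc ‖w i (g, b)‖ ^ 2 * (4 * c)
      ≤ (∑ g, ∑ b, ∑ i, ‖w i (g, b)‖ ^ 2) * (4 * c) :=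
        mul_le_mul_of_nonneg_right (s1.trans (s2.trans s3)) (by positivity)
    _ = _ := by ring

/-- The displacements `i ↦ ∑_j h_{ij} |v_j⟩` for Hermitian `h`. -/
def gaugeSpace {κ : Type} (v : Fin q → κ → ℂ) : Submodule ℝ (Fin q → κ → ℂ) where
  carrier := {y | ∃ h : Matrix (Fin q) (Fin q) ℂ, h.IsHermitian ∧
    y = fun i m => ∑ j, h i j * v j m}
  add_mem' := by
    rintro _ _ ⟨h, hh, rfl⟩ ⟨h', hh', rfl⟩
    refine ⟨h + h', hh.add hh', ?_⟩
    ext i m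
    simp [add_mul, Finset.sum_add_distrib]
  zero_mem' := ⟨0, isHermitian_zero, by ext; simp⟩
  smul_mem' := by
    rintro r _ ⟨h, hh, rfl⟩
    refine ⟨(r : ℂ) • h, hh.real_smul r, ?_⟩
    ext i m
    simp [Finset.mul_sum, mul_assoc]

end RedGram

/-! ### Minimax over combs and gauges -/

section Minimax

variable {d : ℕ → ℕ} {n q : ℕ}

theorem redPerfOp_eq_redGram (v : Fin q → ℝ → Idx d (2 * n + 2) → ℂ) (θ : ℝ)
    (h : Matrix (Fin q) (Fin q) ℂ) :
    redPerfOp d n v θ h =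
      redGram (γ := Idx d (2 * n + 1)) (β := Fin (d (2 * n + 2))) (dotVec v θ h) := rfl

/-- The minimization runs over the displacement `y = h v` instead of `h`: if the vectors `v i θ` are
dependent, the objective is not coercive in `h`. In `y` it is coercive already at the comb `c • 1`.
-/
theorem exists_saddlePoint_redPerfOp (hd : ∀ i, 0 < d i)
    (v : Fin q → ℝ → Idx d (2 * n + 2) → ℂ) (θ : ℝ) :
    ∃ h₀ : Matrix (Fin q) (Fin q) ℂ, h₀.IsHermitian ∧ ∃ R₀, IsComb d (2 * n + 1) R₀ ∧
      ∀ h : Matrix (Fin q) (Fin q) ℂ, h.IsHermitian → ∀ R, IsComb d (2 * n + 1) R →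
        (trace (R * redPerfOp d n v θ h₀)).re ≤ (trace (R₀ * redPerfOp d n v θ h)).re := by
  let a : Fin q → Idx d (2 * n + 1) × Fin (d (2 * n + 2)) → ℂ :=
    fun i m => deriv (fun t => v i t m) θ
  let V : Submodule ℝ (Fin q → Idx d (2 * n + 1) × Fin (d (2 * n + 2)) → ℂ) :=
    gaugeSpace fun i => v i θ
  let f : (Fin q → Idx d (2 * n + 1) × Fin (d (2 * n + 2)) → ℂ) → Op d (2 * n + 1) → ℝ :=
    fun y R => (trace (R * redGram (a - Complex.I • y))).re
  obtain ⟨c, hc, hcomb⟩ := exists_isComb_smul_one hd n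
  have hsaddle := exists_saddlePoint V (isCompact_isComb hd n) (convex_isComb hd n) (f := f)
    ?_ ?_ ?_ ?_ hcomb ?_
  · obtain ⟨y₀, ⟨h₀, hh₀, rfl⟩, R₀, hR₀, hle⟩ := hsaddle
    exact ⟨h₀, hh₀, R₀, hR₀, fun h hh R hR => hle _ ⟨h, hh, rfl⟩ R hR⟩
  · intro R hR
    have hconv := convexOn_trace_mul_redGram (β := Fin (d (2 * n + 2))) (q := q)
      (IsComb.posSemidef hR)
    refine ⟨convex_univ, fun y _ y' _ s t hs ht hst => ?_⟩
    have e : a - Complex.I • (s • y + t • y') =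
        s • (a - Complex.I • y) + t • (a - Complex.I • y') := by
      have : a = s • a + t • a := by rw [← add_smul, hst, one_smul]
      conv_lhs => rw [this]
      simp only [smul_add, smul_sub, smul_comm Complex.I]
      abel
    have := hconv.2 (Set.mem_univ (a - Complex.I • y)) (Set.mem_univ (a - Complex.I • y'))
      hs ht hst
    rw [← e] at this
    exact this
  · intro R hR
    have h1 : Continuous fun y : Fin q → Idx d (2 * n + 1) × Fin (d (2 * n + 2)) → ℂ =>
        redGram (a - Complex.I • y) := continuous_redGram.comp (by fun_prop)
    fun_prop
  · intro y
    refine ⟨convex_isComb hd n, fun R _ R' _ s t hs ht hst => le_of_eq ?_⟩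
    simp only [f, Matrix.add_mul, Matrix.smul_mul, trace_add, trace_smul, Complex.add_re,
      Complex.smul_re]
  · intro y
    fun_prop
  · intro M
    refine ⟨Real.sqrt (M / (4 * c)) + ‖a‖, fun y _ hy => ?_⟩
    set w := a - Complex.I • y with hw
    have h1 : c * (trace (redGram w)).re ≤ M := by
      have : f y ((c : ℂ) • 1) = c * (trace (redGram w)).re := by
        simp only [f]
        rw [Matrix.smul_mul, Matrix.one_mul, trace_smul, smul_eq_mul, Complex.re_ofReal_mul]
      rw [← this]
      exact hy
    have h3 := norm_le_of_trace_redGram_le hc h1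
    have h4 : ‖y‖ = ‖a - w‖ := by
      rw [hw, sub_sub_cancel, norm_smul, Complex.norm_I, one_mul]
    rw [h4]
    refine (norm_sub_le _ _).trans ?_
    linarith

end Minimax

/-! ### Probes -/

section Probe

variable {d : ℕ → ℕ} {n : ℕ}

theorem exists_pure_probe {R : Op d (2 * n + 1)} (hR : IsComb d (2 * n + 1) R) :
    ∃ (a : ℕ) (ψ : Idx d (2 * n + 1) × Fin a → ℂ), IsProbe d n a (vecMulVec ψ (star ψ)) ∧
      partialTrace (vecMulVec ψ (star ψ)) = R := by
  obtain ⟨X, hX⟩ := exists_eq_mul_conjTranspose (IsComb.posSemidef hR)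
  let e := Fintype.equivFin (Idx d (2 * n + 1))
  let ψ : Idx d (2 * n + 1) × Fin (Fintype.card (Idx d (2 * n + 1))) → ℂ :=
    fun x => X x.1 (e.symm x.2)
  have hpt : partialTrace (vecMulVec ψ (star ψ)) = R := by
    rw [hX]
    ext g g'
    exact Fintype.sum_equiv e.symm _ (fun k => X g k * star (X g' k)) fun _ => rfl
  exact ⟨_, ψ, ⟨posSemidef_vecMulVec_self_star ψ, by rwa [hpt]⟩, hpt⟩

theorem exists_probe {R : Op d (2 * n + 1)} (hR : IsComb d (2 * n + 1) R) {a : ℕ} (ha : 0 < a) :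
    ∃ T, IsProbe d n a T ∧ partialTrace T = R := by
  let j : Fin a := ⟨0, ha⟩
  let P : Matrix (Fin a) (Fin a) ℂ := vecMulVec (Pi.single j 1) (star (Pi.single j 1))
  have hpt : partialTrace (R ⊗ₖ P) = R := by
    ext g g'
    simp [partialTrace, P, vecMulVec_apply, Pi.single_apply]
  exact ⟨R ⊗ₖ P, ⟨(IsComb.posSemidef hR).kronecker (posSemidef_vecMulVec_self_star _),
    by rwa [hpt]⟩, hpt⟩

end Probe

/-! ### The semidefinite program -/

section SDP

variable {d : ℕ → ℕ} {n q : ℕ} {v : Fin q → ℝ → Idx d (2 * n + 2) → ℂ} {θ : ℝ}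
  {h : Matrix (Fin q) (Fin q) ℂ}

/-- Schur complement with respect to the identity block. The conjugation in `cVec` accounts for the
partial transposition, so that `B B†` is a quarter of the reduced performance operator. -/
theorem blockA_posSemidef_iff (lam : ℝ) (S : Op d (2 * n)) :
    (blockA d n v θ h lam S).PosSemidef ↔
      (tensorOne d (2 * n) ((lam : ℂ) • S) - (1 / 4 : ℂ) • redPerfOp d n v θ h).PosSemidef := by
  let M : Matrix (Fin q × Fin (d (2 * n + 2))) (Idx d (2 * n + 1)) ℂ :=
    of fun im g => star (cVec d n v θ h im.1 im.2 g)
  have hM : (of fun g im => cVec d n v θ h im.1 im.2 g) = Mᴴ := by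
    ext g im
    simp [M]
  have h4 : (1 / 4 : ℂ) • redPerfOp d n v θ h = Mᴴ * M := by
    rw [redPerfOp_eq_redGram, redGram_eq_mul_conjTranspose, smul_smul]
    norm_num
    rw [← conjTranspose_conjTranspose M, conjTranspose_conjTranspose Mᴴ, ← hM]
    rfl
  let := invertibleOne (α := Matrix (Fin q × Fin (d (2 * n + 2))) (Fin q × Fin (d (2 * n + 2))) ℂ)
  have key := PosDef.fromBlocks₁₁ M (tensorOne d (2 * n) ((lam : ℂ) • S))
    (PosDef.one (n := Fin q × Fin (d (2 * n + 2))) (R := ℂ))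
  rw [inv_one, Matrix.mul_one] at key
  rw [blockA, hM, h4]
  exact key

theorem posSemidef_redPerfOp : (redPerfOp d n v θ h).PosSemidef := posSemidef_redGram _

theorem SDPFeasible.chain {lam : ℝ} {S : ∀ k, Op d (2 * k)} (hS : SDPFeasible d n v θ lam h S) :
    Chain d n (S n) 1 := by
  refine chain_of_family (by rw [hS.S_zero]; change (1 : Op d 0) = _; simp) (fun k hk => ?_)
    hS.S_norm
  rcases Nat.eq_zero_or_pos k with rfl | hk0
  · rw [hS.S_zero]; exact isHermitian_one
  · exact hS.S_herm k hk0 hk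

theorem SDPFeasible.trace_mul_redPerfOp_le {lam : ℝ} {S : ∀ k, Op d (2 * k)}
    (hS : SDPFeasible d n v θ lam h S) {R : Op d (2 * n + 1)} (hR : IsComb d (2 * n + 1) R) :
    (trace (R * redPerfOp d n v θ h)).re ≤ 4 * lam := by
  have h1 := hR.posSemidef.trace_mul_re_le ((blockA_posSemidef_iff lam (S n)).1 hS.block)
  rw [hR.trace_mul_tensorOne_of_chain (hS.chain.smul lam), Matrix.mul_smul, trace_smul,
    smul_eq_mul, Complex.ofReal_re] at h1
  have h4 : (1 / 4 : ℂ) = ((1 / 4 : ℝ) : ℂ) := by norm_num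
  rw [h4, Complex.re_ofReal_mul] at h1
  linarith

theorem DualFeasible.trace_mul_redPerfOp_le {S : ∀ k, Op d (2 * k)}
    (hS : DualFeasible d n v θ h S) {R : Op d (2 * n + 1)} (hR : IsComb d (2 * n + 1) R) :
    (trace (R * redPerfOp d n v θ h)).re ≤ dualObjective d S :=
  (hR.posSemidef.trace_mul_re_le hS.last).trans (hR.trace_mul_tensorOne_le hS.le)

theorem exists_dualFeasible_tight (hd : ∀ i, 0 < d i) {p : ℝ}
    (hp : ∀ R, IsComb d (2 * n + 1) R → (trace (R * redPerfOp d n v θ h)).re ≤ p) :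
    ∃ S, DualFeasible d n v θ h S ∧ DualTight d n S ∧ S 0 = (p : ℂ) • (1 : Op d 0) := by
  obtain ⟨S, hS, hW⟩ := exists_chain_of_forall_le hd
    (posSemidef_redPerfOp (v := v) (θ := θ) (h := h)).isHermitian hp
  obtain ⟨F, rfl, h0, hF, ht⟩ := hS.exists_family
  exact ⟨F, ⟨hF, fun k hk => by rw [ht k hk, sub_self]; exact PosSemidef.zero, hW⟩, ht, h0⟩

theorem dualObjective_of_zero_eq {S : ∀ k, Op d (2 * k)} {p : ℝ}
    (h0 : S 0 = (p : ℂ) • (1 : Op d 0)) : dualObjective d S = p := by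
  rw [dualObjective, h0]
  have := trace_smul_one_op_zero (d := d) p
  rw [this, Complex.ofReal_re]

theorem exists_sdpFeasible (hd : ∀ i, 0 < d i) (hh : h.IsHermitian) {p : ℝ}
    (hp : ∀ R, IsComb d (2 * n + 1) R → (trace (R * redPerfOp d n v θ h)).re ≤ p) :
    ∃ S, SDPFeasible d n v θ (p / 4) h S := by
  obtain ⟨c, hc, hcomb⟩ := exists_isComb_smul_one hd n
  have hW := posSemidef_redPerfOp (v := v) (θ := θ) (h := h)
  have hW0 := (Complex.le_def.1 hW.trace_nonneg).1
  have htr : c * (trace (redPerfOp d n v θ h)).re ≤ p := by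
    have := hp _ hcomb
    rwa [Matrix.smul_mul, Matrix.one_mul, trace_smul, smul_eq_mul, Complex.re_ofReal_mul] at this
  have hp0 : 0 ≤ p := (mul_nonneg hc.le hW0).trans htr
  -- Dual points are normalized by dividing by `p`. When `p = 0` this is impossible, but the
  -- performance operator then vanishes and any normalized chain works with `λ = 0`.
  rcases hp0.eq_or_lt with rfl | hpos
  · have hz : redPerfOp d n v θ h = 0 := by
      rw [← hW.trace_eq_zero_iff]
      have h1 : (trace (redPerfOp d n v θ h)).re = 0 := by
        refine le_antisymm ?_ hW0
        by_contra hlt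
        push Not at hlt
        exact absurd htr (not_le.2 (mul_pos hc hlt))
      exact Complex.ext h1 (Complex.le_def.1 hW.trace_nonneg).2.symm
    obtain ⟨c', -, hchain⟩ := exists_chain_one d n hd
    obtain ⟨F, -, h0, hF, ht⟩ := hchain.exists_family
    refine ⟨F, ⟨by norm_num, hh, fun k _ hk => hF k hk, ?_, ht, ?_⟩⟩
    · rw [h0]; change _ = (1 : Op d 0); simp
    · rw [blockA_posSemidef_iff, hz, tensorOne_smul]
      simpa using PosSemidef.zero (n := Idx d (2 * n + 1)) (R := ℂ)
  · obtain ⟨S, hS, ht, h0⟩ := exists_dualFeasible_tight hd hp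
    refine ⟨fun k => ((p⁻¹ : ℝ) : ℂ) • S k, ⟨by positivity, hh,
      fun k _ hk => (hS.herm k hk).real_smul _, ?_, fun k hk => ?_, ?_⟩⟩
    · have : ((p⁻¹ : ℝ) : ℂ) • ((p : ℂ) • (1 : Op d 0)) = 1 := by
        rw [smul_smul, ← Complex.ofReal_mul, inv_mul_cancel₀ hpos.ne', Complex.ofReal_one, one_smul]
      rw [h0]
      exact this
    · rw [tensorOne_smul, ← ht k hk]
      exact trLast_smul _ _
    · rw [blockA_posSemidef_iff]
      have h1 := hS.last.real_smul (by norm_num : (0 : ℝ) ≤ 1 / 4)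
      have h2 : ((p / 4 : ℝ) : ℂ) • ((p⁻¹ : ℝ) : ℂ) • S n = ((1 / 4 : ℝ) : ℂ) • S n := by
        rw [smul_smul, ← Complex.ofReal_mul]
        congr 2
        field_simp
      rw [h2, tensorOne_smul]
      rw [smul_sub] at h1
      have h4 : (1 / 4 : ℂ) = ((1 / 4 : ℝ) : ℂ) := by norm_num
      rw [h4]
      exact h1

end SDP

end QComb

/-! ### The main theorem -/

theorem mainTheorem2
    -- combs with `N = n + 1 ≥ 1` teeth on the spaces `H_i = ℂ^(d i)`, `1 ≤ i ≤ 2 N = 2 n + 2`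
    (n : ℕ) (d : ℕ → ℕ) (hd : ∀ i, 0 < d i)
    (Θ : Set ℝ) (hΘ : IsOpen Θ) (θ : ℝ) (hθ : θ ∈ Θ)
    (C : ℝ → QComb.Op d (2 * n + 2)) (hC : ∀ t ∈ Θ, QComb.IsComb d (2 * n + 2) (C t))
    -- a continuously differentiable ensemble decomposition of the family
    (q : ℕ) (v : Fin q → ℝ → QComb.Idx d (2 * n + 2) → ℂ)
    (hv : ∀ i m, ContDiffOn ℝ 1 (fun t => v i t m) Θ)
    (hCv : ∀ t ∈ Θ, C t = ∑ i, Matrix.vecMulVec (v i t) (star (v i t)))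
    -- for each pure probe, the rank of the output state does not depend on the parameter
    (hrank : ∀ (a : ℕ) (ψ : QComb.Idx d (2 * n + 1) × Fin a → ℂ),
      QComb.IsProbe d n a (Matrix.vecMulVec ψ (star ψ)) → ∀ s ∈ Θ, ∀ t ∈ Θ,
        (QComb.outputState d n a (C s) (Matrix.vecMulVec ψ (star ψ))).rank =
          (QComb.outputState d n a (C t) (Matrix.vecMulVec ψ (star ψ))).rank) :
    -- every output state has a symmetric logarithmic derivative, and the maximum that defines
    -- the comb QFI is attained
    (∀ (a : ℕ) (T : Matrix (QComb.Idx d (2 * n + 1) × Fin a)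
        (QComb.Idx d (2 * n + 1) × Fin a) ℂ), QComb.IsProbe d n a T →
        ∃ L, QComb.IsSLD (fun t => QComb.outputState d n a (C t) T) θ L) ∧
    IsGreatest (QComb.probeQFIs d n C θ) (QComb.combQFI d n C θ) ∧
    -- the comb QFI is four times the optimal value of the semidefinite program
    (∃ lamStar : ℝ,
      IsLeast {lam : ℝ | ∃ h S, QComb.SDPFeasible d n v θ lam h S} lamStar ∧
      QComb.combQFI d n C θ = 4 * lamStar) ∧
    -- positivity of the block matrix encodes `𝟙_{2N-1} ⊗ λ S ⪰ tr_{2N} Ω_θ(h) / 4`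
    (∀ (h : Matrix (Fin q) (Fin q) ℂ) (lam : ℝ) (S : QComb.Op d (2 * n)),
      (QComb.blockA d n v θ h lam S).PosSemidef ↔
        (QComb.tensorOne d (2 * n) ((lam : ℂ) • S) -
          (1 / 4 : ℂ) • QComb.redPerfOp d n v θ h).PosSemidef) ∧
    -- strong duality for every fixed `h` and every ancilla, with inequality constraints, with
    -- equality constraints, and in the normalized form of the semidefinite program
    (∀ h : Matrix (Fin q) (Fin q) ℂ, h.IsHermitian → ∃ val : ℝ,
      (∀ a : ℕ, 0 < a → IsGreatest (QComb.primalValues d n a v θ h) val) ∧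
      IsLeast {x : ℝ | ∃ S, QComb.DualFeasible d n v θ h S ∧
        x = QComb.dualObjective d S} val ∧
      IsLeast {x : ℝ | ∃ S, QComb.DualFeasible d n v θ h S ∧ QComb.DualTight d n S ∧
        x = QComb.dualObjective d S} val ∧
      IsLeast {x : ℝ | ∃ lam S, QComb.SDPFeasible d n v θ lam h S ∧ x = 4 * lam} val) ∧
    -- every dual feasible point can be modified so as to satisfy the first constraints with
    -- equality, without changing the objective
    (∀ (h : Matrix (Fin q) (Fin q) ℂ) (S : ∀ k, QComb.Op d (2 * k)), h.IsHermitian →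
      QComb.DualFeasible d n v θ h S →
      ∃ S' : ∀ k, QComb.Op d (2 * k), QComb.DualFeasible d n v θ h S' ∧
        QComb.DualTight d n S' ∧ QComb.dualObjective d S' = QComb.dualObjective d S) := by
  have hv' : ∀ i m, DifferentiableAt ℝ (fun t => v i t m) θ := fun i m =>
    ((hv i m).differentiableOn one_ne_zero).differentiableAt (hΘ.mem_nhds hθ)
  have hΘ' : ∀ᶠ t in nhds θ, t ∈ Θ := hΘ.mem_nhds hθ
  have hCv' : ∀ᶠ t in nhds θ, C t = ∑ i, Matrix.vecMulVec (v i t) (star (v i t)) :=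
    hΘ'.mono hCv
  have hle : ∀ (a : ℕ) T, QComb.IsProbe d n a T → ∀ h : Matrix (Fin q) (Fin q) ℂ, h.IsHermitian →
      QComb.stateQFI (fun t => QComb.outputState d n a (C t) T) θ ≤
        (Matrix.trace (QComb.partialTrace T * QComb.redPerfOp d n v θ h)).re := by
    intro a T hT h hh
    obtain ⟨B, rfl⟩ := QComb.exists_eq_mul_conjTranspose hT.1
    exact QComb.stateQFI_linkProduct_le (γ := QComb.Idx d (2 * n + 1))
      (β := Fin (d (2 * n + 2))) (C := C) hv' hCv' B hh
  obtain ⟨h₀, hh₀, R₀, hR₀, hsaddle⟩ := QComb.exists_saddlePoint_redPerfOp hd v θ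
  set val := (Matrix.trace (R₀ * QComb.redPerfOp d n v θ h₀)).re with hval
  have hgreatest : IsGreatest (QComb.probeQFIs d n C θ) val := by
    refine ⟨?_, ?_⟩
    · obtain ⟨a, ψ, hψ, hψR⟩ := QComb.exists_pure_probe hR₀
      -- The purification of `R₀` attains the saddle value: its own optimal `h` gives a value no
      -- smaller than that of `h₀`, and `h₀` gives the reverse bound.
      refine ⟨a, _, hψ, le_antisymm ?_ ?_⟩
      · obtain ⟨h, hh, hJ⟩ := QComb.exists_stateQFI_linkProduct_eq
          (γ := QComb.Idx d (2 * n + 1)) (β := Fin (d (2 * n + 2))) (C := C) hv' hCv' ψ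
          (hΘ'.mono fun t ht => hrank a ψ hψ t ht θ hθ)
        have h1 := hsaddle h hh R₀ hR₀
        rw [← hψR] at h1
        rw [hval, ← hψR]
        exact h1.trans (le_of_eq hJ.symm)
      · have := hle a _ hψ h₀ hh₀
        rwa [hψR] at this
    · rintro _ ⟨a, T, hT, rfl⟩
      exact (hle a T hT h₀ hh₀).trans (hsaddle h₀ hh₀ _ hT.2)
  have hcomb : QComb.combQFI d n C θ = val := hgreatest.csSup_eq
  refine ⟨?_, hcomb ▸ hgreatest, ⟨val / 4, ⟨?_, ?_⟩, by rw [hcomb]; ring⟩,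
    fun h lam S => QComb.blockA_posSemidef_iff lam S, ?_, ?_⟩
  · intro a T hT
    obtain ⟨B, rfl⟩ := QComb.exists_eq_mul_conjTranspose hT.1
    exact QComb.exists_isSLD_linkProduct (γ := QComb.Idx d (2 * n + 1))
      (β := Fin (d (2 * n + 2))) (C := C) hv' hCv' B
  · obtain ⟨S, hS⟩ := QComb.exists_sdpFeasible hd hh₀ (hsaddle h₀ hh₀)
    exact ⟨h₀, S, hS⟩
  · rintro lam ⟨h, S, hS⟩
    have h1 := hS.trace_mul_redPerfOp_le hR₀
    have h2 := hsaddle h hS.h_herm R₀ hR₀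
    linarith
  · intro h hh
    have hcont : Continuous fun R : QComb.Op d (2 * n + 1) =>
        (Matrix.trace (R * QComb.redPerfOp d n v θ h)).re := by fun_prop
    obtain ⟨R, hR, hmax⟩ := (QComb.isCompact_isComb hd n).exists_isMaxOn ⟨R₀, hR₀⟩
      hcont.continuousOn
    have hmax' : ∀ R', QComb.IsComb d (2 * n + 1) R' →
        (Matrix.trace (R' * QComb.redPerfOp d n v θ h)).re ≤
          (Matrix.trace (R * QComb.redPerfOp d n v θ h)).re := fun R' hR' => hmax hR'
    obtain ⟨S, hS, hSt, hS0⟩ := QComb.exists_dualFeasible_tight hd hmax'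
    have hobj := QComb.dualObjective_of_zero_eq hS0
    refine ⟨(Matrix.trace (R * QComb.redPerfOp d n v θ h)).re, fun a ha => ⟨?_, ?_⟩,
      ⟨⟨S, hS, hobj.symm⟩, ?_⟩, ⟨⟨S, hS, hSt, hobj.symm⟩, ?_⟩, ⟨?_, ?_⟩⟩
    · obtain ⟨T, hT, hTR⟩ := QComb.exists_probe hR ha
      refine ⟨T, hT, ?_⟩
      rw [QComb.trace_mul_kronecker_one, hTR]
    · rintro _ ⟨T, hT, rfl⟩
      rw [QComb.trace_mul_kronecker_one]
      exact hmax' _ hT.2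
    · rintro _ ⟨S', hS', rfl⟩
      exact hS'.trace_mul_redPerfOp_le hR
    · rintro _ ⟨S', hS', -, rfl⟩
      exact hS'.trace_mul_redPerfOp_le hR
    · obtain ⟨S', hS'⟩ := QComb.exists_sdpFeasible hd hh hmax'
      exact ⟨_, S', hS', by ring⟩
    · rintro _ ⟨lam, S', hS', rfl⟩
      exact hS'.trace_mul_redPerfOp_le hR
  · intro h S _ hS
    -- The tight point is not built from `S`: weak duality makes the objective of `S` an upper bound
    -- of the primal, and strong duality realizes any such bound exactly.
    obtain ⟨S', hS', ht, h0⟩ := QComb.exists_dualFeasible_tight hd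
      fun R hR => hS.trace_mul_redPerfOp_le hR
    exact ⟨S', hS', ht, QComb.dualObjective_of_zero_eq h0⟩
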